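/- **Setting.** Let $L\ge 1$ be an integer and let $\mathbb T^L=\mathbb R^L/(2\pi\mathbb Z)^L$ be the flat torus with angular coordinates $\theta_1,\dots,\theta_L$. For $\vec m\in\mathbb Z^L$ put $p(\vec m)=\sqrt2\,(2\pi)^{-L/2}$ if $\vec m\ne 0$, $p(\vec 0)=(2\pi)^{-L/2}$, and $$\widehat A_{\vec m}=p(\vec m)\cos\Big(\sum_j m_j\theta_j\Big),\qquad \widehat B_{\vec m}=p(\vec m)\sin\Big(\sum_j m_j\theta_j\Big).$$ Let $\mathcal C_L\subset\mathbb Z^L$ be the set of vectors whose first nonzero entry is positive. A finite set $\mathcal M\subset\mathcal C_L$ is *symmetric* if for all $\vec m\in\mathcal C_L$ and all permutations $\varphi$ of $\{1,\dots,L\}$ we have $(m_1,\dots,m_L)\in\mathcal M\iff(m_{\varphi(1)},\dots,m_{\varphi(L)})\in\mathcal M\cup(-\mathcal M)$. Let $\boldsymbol V(\mathcal M)=\mathrm{span}\{\widehat A_{\vec m},\widehat B_{\vec m}:\vec m\in\mathcal M\}$, with the $L^2(\mathbb T^L)$ inner product $(-,-)$, and set $$a_{jk}=\frac{2}{(2\pi)^L}\sum_{\vec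 m\in\mathcal M}m_jm_k,\qquad \vec a_{jk}=-\frac{2^{1/2}}{(2\pi)^{L/2}}\sum_{\vec m\in\mathcal M}m_jm_k\,\widehat A_{\vec m}\in\boldsymbol V(\mathcal M).$$ If $\mathcal M$ is symmetric, then $a_{jj}$ does not depend on $j$ and $a_{jk}$, $j\neq k$, does not depend on $j\ne k$; the common values are denoted by $a$ and $b$ (with $b:=0$ if $L=1$). The space $\boldsymbol V(\mathcal M)$ is *ample* if for every $x\in\mathbb T^L$ and every covector $\xi\in T_x^*\mathbb T^L$ there is $v\in\boldsymbol V(\mathcal M)$ with $d_xv=\xi$. The expected number $\mu(\mathcal M)$ of critical points is the average, with respect to the area measure, of the number of critical points of $v$ over the unit sphere of $\boldsymbol V(\mathcal M)$. Let $\mathrm{Sym}_L$ be the Euclidean space of real symmetric $L\times L$ matrices with orthonormal basis $(H_{ij})_{1\le i\le j\le L}$, where $H_{ij}$ has entries $1$ at the locations $(i,j)$ and $(j,i)$ and $0$ elsewhere, with inner product $\langle-,-\rangle$ and volume element $|dX|=\prod_{i\le j}dx_{ij}$ for $X=\sum_{i\le j}x_{ij}H_{ij}$. **Theorem.** Suppose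 that $\mathcal M\subset\mathcal C_L$ is a symmetric finite set of cardinality $N>L$. (a) $\boldsymbol V(\mathcal M)$ is ample if and only if $a\ne b$ and $a+(L-1)b\neq 0$. (b) Suppose that the vectors $\vec a_{ij}$, $1\le i\le j\le L$, are linearly independent. Let $\boldsymbol C:\mathrm{Sym}_L\to\mathrm{Sym}_L$ be the symmetric operator whose matrix in the basis $(H_{ij})$ is $\boldsymbol C_{ij;k\ell}=(\vec a_{ij},\vec a_{k\ell})$. Then $$\boldsymbol C_{ij;k\ell}=\frac{2}{(2\pi)^L}\sum_{\vec m\in\mathcal M}m_im_jm_km_\ell$$ and $$\mu(\mathcal M)=\frac{1}{(2\pi)^{\frac12\binom L2}\,(a-b)^{\frac{L-1}{2}}\,\bigl(a+(L-1)b\bigr)^{1/2}\,(\det\boldsymbol C)^{1/2}}\int_{\mathrm{Sym}_L}e^{-\frac12\langle\boldsymbol C^{-1}X,X\rangle}\,|\det X|\,|dX|.$$ In particular $\mu(\mathcal M)$ is finite. -/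

import Mathlib

open MeasureTheory
open scoped ENNReal

noncomputable section

namespace TrigNewton

instance two_pi_pos_fact : Fact (0 < 2 * Real.pi) := ⟨Real.two_pi_pos⟩

/-- The flat torus `ℝ^L / (2πℤ)^L`. Its `volume` is the product of the arc length measures, of
total mass `(2π)^L`. -/
abbrev Torus (L : ℕ) : Type := Fin L → AddCircle (2 * Real.pi)

/-- The covering map `ℝ^L → ℝ^L / (2πℤ)^L`. -/
def proj {L : ℕ} (t : EuclideanSpace ℝ (Fin L)) : Torus L :=
  fun j => ((t j : ℝ) : AddCircle (2 * Real.pi))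

/-- The cosine as a function on the circle `ℝ / 2πℤ`. -/
def circleCos : AddCircle (2 * Real.pi) → ℝ := Real.cos_periodic.lift

/-- The sine as a function on the circle `ℝ / 2πℤ`. -/
def circleSin : AddCircle (2 * Real.pi) → ℝ := Real.sin_periodic.lift

theorem continuous_circleCos : Continuous circleCos :=
  continuous_coinduced_dom.mpr Real.continuous_cos

theorem continuous_circleSin : Continuous circleSin :=
  continuous_coinduced_dom.mpr Real.continuous_sin

/-! ### Differentials, critical points, ampleness -/

/-- `f` is differentiable at the point `x` of the torus with differential `ξ`. The tangent space at
`x` is identified with `ℝ^L` through the angular coordinates. -/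
def HasDifferentialAt {L : ℕ} (f : Torus L → ℝ) (ξ : EuclideanSpace ℝ (Fin L) →L[ℝ] ℝ)
    (x : Torus L) : Prop :=
  HasFDerivAt (fun t : EuclideanSpace ℝ (Fin L) => f (x + proj t)) ξ 0

/-- The set of critical points of `f`. -/
def criticalSet {L : ℕ} (f : Torus L → ℝ) : Set (Torus L) :=
  {x | HasDifferentialAt f 0 x}

/-- A space of functions on the torus is ample if at every point every covector is the differential
of some function of the space. -/
def IsAmple {L : ℕ} (V : Submodule ℝ C(Torus L, ℝ)) : Prop :=
  ∀ (x : Torus L) (ξ : EuclideanSpace ℝ (Fin L) →L[ℝ] ℝ), ∃ v ∈ V, HasDifferentialAt v ξ x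

/-! ### The `L²` inner product and the expected number of critical points -/

/-- The `L²` inner product on the torus. -/
def l2Inner {L : ℕ} (f g : C(Torus L, ℝ)) : ℝ := ∫ x, f x * g x

theorem integrable_mul {L : ℕ} (f g : C(Torus L, ℝ)) :
    Integrable (fun x => f x * g x) (volume : Measure (Torus L)) :=
  (f * g).continuous.integrable_of_hasCompactSupport
    (HasCompactSupport.of_compactSpace _)

theorem eq_zero_of_l2Inner_self {L : ℕ} (f : C(Torus L, ℝ)) (h : l2Inner f f = 0) : f = 0 := by
  have h1 := (integral_eq_zero_iff_of_nonneg (fun x => mul_self_nonneg (f x))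
    (integrable_mul f f)).1 h
  have h2 := (Continuous.ae_eq_iff_eq (volume : Measure (Torus L)) (f * f).continuous
    continuous_zero).1 h1
  ext x
  exact mul_self_eq_zero.1 (congrFun h2 x)

/-- The vector space `V`, as a type that carries the norm of `L²` (and not the sup norm). -/
def L2Space {L : ℕ} (V : Submodule ℝ C(Torus L, ℝ)) : Type := V

section L2Space

variable {L : ℕ} (V : Submodule ℝ C(Torus L, ℝ))

instance : AddCommGroup (L2Space V) := inferInstanceAs (AddCommGroup V)

instance : Module ℝ (L2Space V) := inferInstanceAs (Module ℝ V)

instance [h : FiniteDimensional ℝ V] : FiniteDimensional ℝ (L2Space V) := h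

/-- An element of `L2Space V` as a function on the torus. -/
def L2Space.toFun {V : Submodule ℝ C(Torus L, ℝ)} (v : L2Space V) : C(Torus L, ℝ) :=
  Submodule.subtype V v

/-- The inner product of `L2Space V` is `l2Inner`. -/
abbrev l2Core : InnerProductSpace.Core ℝ (L2Space V) where
  inner f g := l2Inner f.toFun g.toFun
  conj_inner_symm f g := by simp [l2Inner, mul_comm]
  re_inner_nonneg f := integral_nonneg fun x => mul_self_nonneg _
  add_left f g h := by
    have : (f + g).toFun = f.toFun + g.toFun := rfl
    simp only [l2Inner, this, ContinuousMap.add_apply, add_mul]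
    exact integral_add (integrable_mul _ _) (integrable_mul _ _)
  smul_left f g r := by
    have : (r • f).toFun = r • f.toFun := rfl
    simp only [l2Inner, this, ContinuousMap.smul_apply, smul_eq_mul, mul_assoc]
    exact integral_const_mul _ _
  definite f h := Subtype.ext (eq_zero_of_l2Inner_self f.toFun h)

instance : NormedAddCommGroup (L2Space V) :=
  @InnerProductSpace.Core.toNormedAddCommGroup ℝ (L2Space V) _ _ _ (l2Core V)

instance : InnerProductSpace ℝ (L2Space V) :=
  InnerProductSpace.ofCore (l2Core V).toCore

instance : MeasurableSpace (L2Space V) := borel _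

instance : BorelSpace (L2Space V) := ⟨rfl⟩

/-- The expected number of critical points of a random function of `V`: the average, with respect to
the area measure, of the number of critical points over the unit sphere of `V`, where `V` carries
the `L²` inner product. It is an element of `[0, ∞]`. -/
def expectedCritical [FiniteDimensional ℝ V] : ℝ≥0∞ :=
  (∫⁻ v : Metric.sphere (0 : L2Space V) 1,
      ((criticalSet (v : L2Space V).toFun).encard : ℝ≥0∞)
        ∂((volume : Measure (L2Space V)).toSphere)) /
    ((volume : Measure (L2Space V)).toSphere Set.univ)

end L2Space

/-! ### Trigonometric polynomials with given frequencies -/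

/-- The normalizing factor `p(m)`. -/
def normFactor {L : ℕ} (m : Fin L → ℤ) : ℝ :=
  if m = 0 then 1 / (2 * Real.pi) ^ ((L : ℝ) / 2) else √2 / (2 * Real.pi) ^ ((L : ℝ) / 2)

/-- The function `p(m) cos (m₁θ₁ + ⋯ + m_Lθ_L)`. -/
def cosFun {L : ℕ} (m : Fin L → ℤ) : C(Torus L, ℝ) where
  toFun θ := normFactor m * circleCos (∑ j, m j • θ j)
  continuous_toFun := by
    have := continuous_circleCos
    fun_prop

/-- The function `p(m) sin (m₁θ₁ + ⋯ + m_Lθ_L)`. -/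
def sinFun {L : ℕ} (m : Fin L → ℤ) : C(Torus L, ℝ) where
  toFun θ := normFactor m * circleSin (∑ j, m j • θ j)
  continuous_toFun := by
    have := continuous_circleSin
    fun_prop

/-- The positive cone of `ℤ^L` for the lexicographic order: the vectors whose first nonzero entry is
positive. -/
def posCone (L : ℕ) : Set (Fin L → ℤ) := {m | ∃ i, 0 < m i ∧ ∀ j < i, m j = 0}

/-- A set `M` of frequencies in the positive cone is symmetric if, for every `m` in the cone and
every permutation `σ` of the coordinates, `m ∈ M` if and only if the permuted vector lies in
`M ∪ -M`. -/
def IsSymmetric {L : ℕ} (M : Finset (Fin L → ℤ)) : Prop :=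
  ∀ (σ : Equiv.Perm (Fin L)), ∀ m ∈ posCone L,
    (m ∈ M ↔ (fun i => m (σ i)) ∈ M ∨ -(fun i => m (σ i)) ∈ M)

/-- The space `V(M)` of trigonometric polynomials. -/
def trigSpace {L : ℕ} (M : Finset (Fin L → ℤ)) : Submodule ℝ C(Torus L, ℝ) :=
  Submodule.span ℝ (cosFun '' (M : Set (Fin L → ℤ)) ∪ sinFun '' (M : Set (Fin L → ℤ)))

instance {L : ℕ} (M : Finset (Fin L → ℤ)) : FiniteDimensional ℝ (trigSpace M) :=
  FiniteDimensional.span_of_finite ℝ ((M.finite_toSet.image _).union (M.finite_toSet.image _))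

/-- The scalars `a_{jk}(M)`. -/
def aCoef {L : ℕ} (M : Finset (Fin L → ℤ)) (j k : Fin L) : ℝ :=
  2 / (2 * Real.pi) ^ L * ∑ m ∈ M, (m j : ℝ) * (m k : ℝ)

/-- The common value `a(M)` of the diagonal scalars `a_{jj}(M)` of a symmetric set. -/
def aDiag {L : ℕ} (M : Finset (Fin L → ℤ)) : ℝ :=
  if h : 0 < L then aCoef M ⟨0, h⟩ ⟨0, h⟩ else 0

/-- The common value `b(M)` of the scalars `a_{jk}(M)`, `j ≠ k`, of a symmetric set; it is `0` by
convention if `L = 1`, when there are no such scalars. -/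
def bOff {L : ℕ} (M : Finset (Fin L → ℤ)) : ℝ :=
  if h : 1 < L then aCoef M ⟨0, by omega⟩ ⟨1, h⟩ else 0

theorem posCone_or_neg {L : ℕ} (m : Fin L → ℤ) (h : m ≠ 0) : m ∈ posCone L ∨ -m ∈ posCone L := by
  classical
  have hne : ∃ i, m i ≠ 0 := by
    by_contra hc
    push Not at hc
    exact h (funext hc)
  obtain ⟨i, hi, hmin⟩ := WellFounded.has_min (wellFounded_lt (α := Fin L)) {i | m i ≠ 0} hne
  have hz : ∀ j < i, m j = 0 := fun j hj => by
    by_contra hc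
    exact hmin j hc hj
  rcases lt_or_gt_of_ne (show m i ≠ 0 from hi) with h1 | h1
  · exact Or.inr ⟨i, by simpa using h1, fun j hj => by simp [hz j hj]⟩
  · exact Or.inl ⟨i, h1, hz⟩

theorem posCone_ne_zero {L : ℕ} {m : Fin L → ℤ} (h : m ∈ posCone L) : m ≠ 0 := by
  rintro rfl
  obtain ⟨i, hi, _⟩ := h
  simp at hi

theorem posCone_not_neg {L : ℕ} {m : Fin L → ℤ} (h : m ∈ posCone L) : -m ∉ posCone L := by
  rintro ⟨k, hk, hk'⟩
  obtain ⟨i, hi, hi'⟩ := h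
  simp only [Pi.neg_apply] at hk hk'
  rcases lt_trichotomy i k with hl | hl | hl
  · have := hk' i hl
    omega
  · subst hl
    omega
  · have := hi' k hl
    omega

/-- The scalars `a_{jk}` of a symmetric set are invariant under permutations of the indices. -/
theorem aCoef_perm {L : ℕ} {M : Finset (Fin L → ℤ)} (hM : ∀ m ∈ M, m ∈ posCone L)
    (hs : IsSymmetric M) (σ : Equiv.Perm (Fin L)) (j k : Fin L) :
    aCoef M (σ j) (σ k) = aCoef M j k := by
  classical
  unfold aCoef
  congr 1
  have hperm0 : ∀ m : Fin L → ℤ, (fun i => m (σ i)) = 0 → m = 0 := fun m h => by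
    funext i
    simpa using congrFun h (σ.symm i)
  let e : (Fin L → ℤ) → (Fin L → ℤ) := fun m =>
    if (fun i => m (σ i)) ∈ M then (fun i => m (σ i)) else -(fun i => m (σ i))
  refine Finset.sum_bij (fun m _ => e m) ?_ ?_ ?_ ?_
  · intro m hm
    rcases (hs σ m (hM m hm)).1 hm with h | h
    · simp [e, h]
    · by_cases h2 : (fun i => m (σ i)) ∈ M
      · simp [e, h2]
      · simpa only [e, if_neg h2] using h
  · intro m hm n hn hmn
    have key : (fun i => m (σ i)) = (fun i => n (σ i)) ∨
        (fun i => m (σ i)) = -(fun i => n (σ i)) := by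
      dsimp only [e] at hmn
      split_ifs at hmn with h1 h2 h2
      · exact Or.inl hmn
      · exact Or.inr hmn
      · exact Or.inr (by rw [← hmn, neg_neg])
      · exact Or.inl (neg_injective hmn)
    rcases key with h | h
    · funext i
      simpa using congrFun h (σ.symm i)
    · exfalso
      have hneg : n = -m := by
        funext i
        have := congrFun h (σ.symm i)
        simp only [Pi.neg_apply, Equiv.apply_symm_apply] at this ⊢
        omega
      exact posCone_not_neg (hM m hm) (hneg ▸ hM n hn)
  · intro n hn
    have hn0 := posCone_ne_zero (hM n hn)
    have hq0 : (fun i => n (σ.symm i)) ≠ 0 := fun h => hn0 (by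
      funext i
      simpa using congrFun h (σ i))
    rcases posCone_or_neg _ hq0 with h | h
    · have hb : (fun i => (fun i => n (σ.symm i)) (σ i)) = n := by
        funext i
        simp
      refine ⟨fun i => n (σ.symm i), (hs σ _ h).2 (Or.inl (by rw [hb]; exact hn)), ?_⟩
      dsimp only [e]
      simp [hn]
    · have hb : (fun i => (-(fun i => n (σ.symm i))) (σ i)) = -n := by
        funext i
        simp
      refine ⟨-(fun i => n (σ.symm i)), (hs σ _ h).2 (Or.inr ?_), ?_⟩
      · rw [hb, neg_neg]
        exact hn
      · have hnot : -n ∉ M := fun hc => posCone_not_neg (hM n hn) (hM _ hc)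
        dsimp only [e]
        rw [hb, if_neg hnot, neg_neg]
  · intro m hm
    dsimp only [e]
    split_ifs <;> simp

/-- The diagonal scalars of a symmetric set all equal `aDiag`. -/
theorem aCoef_diag {L : ℕ} {M : Finset (Fin L → ℤ)} (hM : ∀ m ∈ M, m ∈ posCone L)
    (hs : IsSymmetric M) (j : Fin L) : aCoef M j j = aDiag M := by
  have hL : 0 < L := j.pos
  rw [aDiag, dif_pos hL, ← aCoef_perm hM hs (Equiv.swap ⟨0, hL⟩ j) ⟨0, hL⟩ ⟨0, hL⟩]
  simp

/-- The off-diagonal scalars of a symmetric set all equal `bOff`. -/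
theorem aCoef_off {L : ℕ} {M : Finset (Fin L → ℤ)} (hM : ∀ m ∈ M, m ∈ posCone L)
    (hs : IsSymmetric M) {j k : Fin L} (hjk : j ≠ k) : aCoef M j k = bOff M := by
  have hL : 1 < L := by
    by_contra hc
    exact hjk (Fin.ext (by omega))
  have h0 : (⟨0, by omega⟩ : Fin L) ≠ ⟨1, hL⟩ := by simp
  rw [bOff, dif_pos hL]
  set z : Fin L := ⟨0, by omega⟩
  set o : Fin L := ⟨1, hL⟩
  rw [← aCoef_perm hM hs (Equiv.swap (Equiv.swap z j o) k * Equiv.swap z j) z o]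
  have h1 : Equiv.swap z j o ≠ j := fun h => h0 ((Equiv.swap z j).injective (by simp [h]))
  simp only [Equiv.Perm.mul_apply, Equiv.swap_apply_left]
  rw [Equiv.swap_apply_of_ne_of_ne h1.symm hjk]

/-- The vectors `a_{jk}(M)`; they lie in `V(M)`. -/
def aVec {L : ℕ} (M : Finset (Fin L → ℤ)) (j k : Fin L) : C(Torus L, ℝ) :=
  -(√2 / (2 * Real.pi) ^ ((L : ℝ) / 2)) • ∑ m ∈ M, ((m j : ℝ) * (m k : ℝ)) • cosFun m

/-! ### Symmetric matrices -/

/-- The index set of the basis `H_{ij}`, `i ≤ j`, of the space of symmetric matrices. -/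
abbrev SymIdx (L : ℕ) : Type := {p : Fin L × Fin L // p.1 ≤ p.2}

/-- The symmetric matrix `H_{ij}` with entry `1` at `(i, j)` and at `(j, i)`, and `0` elsewhere. -/
def symBasis {L : ℕ} (p : SymIdx L) : Matrix (Fin L) (Fin L) ℝ :=
  Matrix.of fun i j =>
    if (i = p.1.1 ∧ j = p.1.2) ∨ (i = p.1.2 ∧ j = p.1.1) then 1 else 0

/-- The symmetric matrix `X = ∑_{i ≤ j} x_{ij} H_{ij}` with coordinates `x` in the orthonormal basis
`H_{ij}` of the Euclidean space of symmetric matrices. -/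
def symMatrix {L : ℕ} (x : SymIdx L → ℝ) : Matrix (Fin L) (Fin L) ℝ := ∑ p, x p • symBasis p

/-- The matrix, in the basis `H_{ij}`, of the covariance operator: the Gram matrix of the vectors
`a_{ij}(M)`. -/
def covMatrix {L : ℕ} (M : Finset (Fin L → ℤ)) : Matrix (SymIdx L) (SymIdx L) ℝ :=
  Matrix.of fun p q => l2Inner (aVec M p.1.1 p.1.2) (aVec M q.1.1 q.1.2)

end TrigNewton

end

/-!
Gaussian integration in polar coordinates turns the average over the unit sphere of `V(M)` into an
average over independent standard Gaussian coefficients, since the number of critical points does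
not change under scaling. The pairs of a function and a critical point of it are parametrized by
`twist`: translating by `θ` rotates each pair of coefficients of `cos (m · θ)` and `sin (m · θ)`,
and the origin is critical exactly when the sine coefficients lie in the kernel of the frequency
matrix `A`. So the critical points of a function correspond to the fibre of `twist` over it, and
the area formula with multiplicity expresses the average as a constant times the Gaussian mean of
`|det (A diag(a) Aᵀ)|`, where `a` are the cosine coefficients.

The matrix `A diag(a) Aᵀ` depends on `a` only through the moment matrix `K`, for which `K Kᵀ` is
the covariance matrix `C`, so the mean is the integral over symmetric matrices with the weight of
`C⁻¹`. The constant involves `det (A Aᵀ)`. Up to scale `A Aᵀ` is the matrix `(a_{jk})`, which for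
symmetric `M` has determinant `(a - b) ^ (L - 1) * (a + (L - 1) * b)`; its nonvanishing is also
equivalent to ampleness, by translation invariance.
-/

noncomputable section

namespace TrigNewton

open Set in
theorem exists_injOn_of_approximatesLinearOn {E F : Type*} [NormedAddCommGroup E]
    [NormedSpace ℝ E] [NormedAddCommGroup F] [NormedSpace ℝ F] (f : E → F) (A : E ≃L[ℝ] F) :
    ∃ r : NNReal, r ≠ 0 ∧ ∀ u, ApproximatesLinearOn f (A : E →L[ℝ] F) u r → InjOn f u := by
  rcases subsingleton_or_nontrivial E with hE | hE
  · exact ⟨1, one_ne_zero, fun u _ => (Function.injective_of_subsingleton f).injOn⟩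
  · have hpos : 0 < ‖(A.symm : F →L[ℝ] E)‖₊ :=
      A.subsingleton_or_nnnorm_symm_pos.resolve_left (not_subsingleton E)
    refine ⟨‖(A.symm : F →L[ℝ] E)‖₊⁻¹ / 2, by positivity, fun u hu => ?_⟩
    exact hu.injOn (Or.inr (NNReal.half_lt_self (by positivity)))

open Set in
theorem encard_iUnion_inter_preimage {α β ι : Type*} [Countable ι] {f : α → β}
    {t : ι → Set α} (hdisj : Pairwise (Function.onFun Disjoint t))
    (hinj : ∀ n, InjOn f (t n)) (y : β) :
    (((⋃ n, t n) ∩ f ⁻¹' {y}).encard : ℝ≥0∞) = ∑' n, (f '' t n).indicator 1 y := by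
  let _ : MeasurableSpace α := ⊤
  rw [iUnion_inter, ← Measure.count_apply MeasurableSpace.measurableSet_top, measure_iUnion
    (fun i j hij => (hdisj hij).mono inter_subset_left inter_subset_left)
    fun _ => MeasurableSpace.measurableSet_top]
  refine tsum_congr fun n => ?_
  rw [Measure.count_apply MeasurableSpace.measurableSet_top]
  by_cases hy : y ∈ f '' t n
  · obtain ⟨x, hx, rfl⟩ := hy
    have hfiber : t n ∩ f ⁻¹' {f x} = {x} := Subset.antisymm
      (fun z hz => hinj n hz.1 hx hz.2) (singleton_subset_iff.2 ⟨hx, rfl⟩)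
    simp [hfiber, mem_image_of_mem f hx]
  · have hfiber : t n ∩ f ⁻¹' {y} = ∅ :=
      eq_empty_of_forall_notMem fun z hz => hy ⟨z, hz.1, hz.2⟩
    simp [hfiber, hy]

section AreaFormula

variable {E : Type*} [NormedAddCommGroup E] [NormedSpace ℝ E] [FiniteDimensional ℝ E]
  [MeasurableSpace E] [BorelSpace E] {f : E → E} {s : Set E} {f' : E → E →L[ℝ] E}

open Set in
theorem exists_injOn_partition (hs : MeasurableSet s)
    (hf' : ∀ x ∈ s, HasFDerivWithinAt f (f' x) s x) (hdet : ∀ x ∈ s, (f' x).det ≠ 0) :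
    ∃ t : ℕ → Set E, Pairwise (Function.onFun Disjoint t) ∧ (∀ n, MeasurableSet (t n)) ∧
      s = ⋃ n, t n ∧ ∀ n, InjOn f (t n) := by
  rcases s.eq_empty_or_nonempty with rfl | hne
  · exact ⟨fun _ => ∅, fun _ _ _ => disjoint_bot_left, fun _ => MeasurableSet.empty,
      iUnion_empty.symm, fun _ => injOn_empty f⟩
  have hradius : ∀ A : E →L[ℝ] E, ∃ r : NNReal, r ≠ 0 ∧ (A.det ≠ 0 → ∀ u : Set E,
      ApproximatesLinearOn f A u r → InjOn f u) := by
    intro A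
    by_cases hA : A.det = 0
    · exact ⟨1, one_ne_zero, fun h => absurd hA h⟩
    · obtain ⟨r, hr, hinj⟩ :=
        exists_injOn_of_approximatesLinearOn f (A.toContinuousLinearEquivOfDetNeZero hA)
      exact ⟨r, hr, fun _ u hu => hinj u hu⟩
  choose r hr hinj using hradius
  obtain ⟨t, A, hdisj, hmeas, hcov, happ, hA⟩ :=
    exists_partition_approximatesLinearOn_of_hasFDerivWithinAt f s f' hf' r hr
  refine ⟨fun n => s ∩ t n, fun i j hij => (hdisj hij).mono inter_subset_right inter_subset_right,
    fun n => hs.inter (hmeas n), ?_, fun n => ?_⟩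
  · rw [← inter_iUnion, inter_eq_self_of_subset_left hcov]
  · obtain ⟨y, hy, hAy⟩ := hA hne n
    exact hinj (A n) (hAy ▸ hdet y hy) _ (happ n)

variable (μ : Measure E) [μ.IsAddHaarMeasure] {g : E → ℝ≥0∞}

open Set in
theorem lintegral_encard_fiber_of_det_ne_zero (hs : MeasurableSet s)
    (hf' : ∀ x ∈ s, HasFDerivWithinAt f (f' x) s x) (hdet : ∀ x ∈ s, (f' x).det ≠ 0)
    (hg : Measurable g) :
    Measurable (fun y => ((s ∩ f ⁻¹' {y}).encard : ℝ≥0∞)) ∧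
      ∫⁻ y, ((s ∩ f ⁻¹' {y}).encard : ℝ≥0∞) * g y ∂μ =
        ∫⁻ x in s, ENNReal.ofReal |(f' x).det| * g (f x) ∂μ := by
  obtain ⟨t, hdisj, hmeas, rfl, hinj⟩ := exists_injOn_partition hs hf' hdet
  have hft : ∀ n, ∀ x ∈ t n, HasFDerivWithinAt f (f' x) (t n) x := fun n x hx =>
    (hf' x (mem_iUnion_of_mem n hx)).mono (subset_iUnion t n)
  have himg : ∀ n, MeasurableSet (f '' t n) := fun n =>
    measurable_image_of_fderivWithin (hmeas n) (hft n) (hinj n)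
  have hind : ∀ n, Measurable ((f '' t n).indicator (1 : E → ℝ≥0∞)) := fun n =>
    measurable_one.indicator (himg n)
  simp only [encard_iUnion_inter_preimage hdisj hinj]
  refine ⟨Measurable.tsum hind, ?_⟩
  simp only [← ENNReal.tsum_mul_right]
  rw [lintegral_tsum (f := fun n y => (f '' t n).indicator 1 y * g y)
    fun n => ((hind n).mul hg).aemeasurable, lintegral_iUnion hmeas hdisj]
  refine tsum_congr fun n => ?_
  rw [← lintegral_image_eq_lintegral_abs_det_fderiv_mul μ (hmeas n) (hft n) (hinj n),
    ← lintegral_indicator (himg n)]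
  refine lintegral_congr fun y => ?_
  by_cases hy : y ∈ f '' t n <;> simp [hy]

open Set in
theorem lintegral_encard_fiber (hs : MeasurableSet s)
    (hf' : ∀ x ∈ s, HasFDerivWithinAt f (f' x) s x) (hdet : Measurable fun x => (f' x).det)
    (hg : Measurable g) :
    AEMeasurable (fun y => ((s ∩ f ⁻¹' {y}).encard : ℝ≥0∞)) μ ∧
      ∫⁻ y, ((s ∩ f ⁻¹' {y}).encard : ℝ≥0∞) * g y ∂μ =
        ∫⁻ x in s, ENNReal.ofReal |(f' x).det| * g (f x) ∂μ := by
  set Z : Set E := {x | (f' x).det = 0}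
  have hZ : MeasurableSet Z := hdet (measurableSet_singleton 0)
  obtain ⟨hmeas, harea⟩ := lintegral_encard_fiber_of_det_ne_zero μ (hs.diff hZ)
    (fun x hx => (hf' x hx.1).mono sdiff_subset) (fun x hx => hx.2) hg
  -- By Sard's theorem, the critical points do not contribute.
  have hnull : μ (f '' (s ∩ Z)) = 0 := addHaar_image_eq_zero_of_det_fderivWithin_eq_zero μ
    (fun x hx => (hf' x hx.1).mono inter_subset_left) (fun x hx => hx.2)
  have hae : (fun y => ((s ∩ f ⁻¹' {y}).encard : ℝ≥0∞)) =ᵐ[μ]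
      fun y => (((s \ Z) ∩ f ⁻¹' {y}).encard : ℝ≥0∞) := by
    filter_upwards [measure_eq_zero_iff_ae_notMem.1 hnull] with y hy
    congr 2
    exact Subset.antisymm (fun x hx => ⟨⟨hx.1, fun hxZ => hy ⟨x, ⟨hx.1, hxZ⟩, hx.2⟩⟩, hx.2⟩)
      (inter_subset_inter_left _ sdiff_subset)
  have hzero : ∫⁻ x in s ∩ Z, ENNReal.ofReal |(f' x).det| * g (f x) ∂μ = 0 := by
    rw [setLIntegral_congr_fun (g := fun _ => 0) (hs.inter hZ) fun x hx => by
      simp [show (f' x).det = 0 from hx.2], lintegral_zero]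
  refine ⟨⟨_, hmeas, hae⟩, ?_⟩
  calc ∫⁻ y, ((s ∩ f ⁻¹' {y}).encard : ℝ≥0∞) * g y ∂μ
      = ∫⁻ y, (((s \ Z) ∩ f ⁻¹' {y}).encard : ℝ≥0∞) * g y ∂μ :=
        lintegral_congr_ae (hae.mul (ae_eq_refl g))
    _ = ∫⁻ x in s, ENNReal.ofReal |(f' x).det| * g (f x) ∂μ := by
        rw [harea, ← lintegral_inter_add_sdiff _ s hZ, hzero, zero_add]

end AreaFormula

section Polar

variable {E : Type*} [NormedAddCommGroup E] [NormedSpace ℝ E] [FiniteDimensional ℝ E]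
  [MeasurableSpace E] [BorelSpace E] {μ : Measure E} [μ.IsAddHaarMeasure]
  {n : E → ℝ≥0∞}

theorem volumeIoiPow_ne_zero (k : ℕ) : Measure.volumeIoiPow k ≠ 0 := by
  intro h
  have hIio := Measure.volumeIoiPow_apply_Iio k ⟨1, Set.mem_Ioi.2 zero_lt_one⟩
  rw [h, Measure.coe_zero, Pi.zero_apply, eq_comm, ENNReal.ofReal_eq_zero, one_pow] at hIio
  exact hIio.not_gt (by positivity)

open Set Metric in
theorem aemeasurable_sphere_of_smul (hn : AEMeasurable n μ)
    (hhom : ∀ (r : ℝ) (v : E), 0 < r → n (r • v) = n v) :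
    AEMeasurable (fun v : sphere (0 : E) 1 => n v) μ.toSphere := by
  have hcomap : AEMeasurable (fun x : ({0}ᶜ : Set E) => n x) (μ.comap (↑)) := by
    refine (MeasurableEmbedding.subtype_coe
      (measurableSet_singleton (0 : E)).compl).aemeasurable_map_iff.1 ?_
    rw [map_comap_subtype_coe (measurableSet_singleton _).compl]
    exact hn.restrict
  have hprod := hcomap.comp_quasiMeasurePreserving
    (μ.measurePreserving_homeomorphUnitSphereProd.symm
      (homeomorphUnitSphereProd E).toMeasurableEquiv).quasiMeasurePreserving
  have hfst : AEMeasurable (fun p : sphere (0 : E) 1 × Ioi (0 : ℝ) => n p.1)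
      (μ.toSphere.prod (Measure.volumeIoiPow (Module.finrank ℝ E - 1))) := by
    refine hprod.congr (Filter.Eventually.of_forall fun p => ?_)
    exact hhom p.2 p.1 p.2.2
  exact (hfst.aestronglyMeasurable.of_comp_fst (volumeIoiPow_ne_zero _)).aemeasurable

open Set Metric in
theorem lintegral_mul_fun_norm_eq [Nontrivial E] (hn : AEMeasurable n μ)
    (hhom : ∀ (r : ℝ) (v : E), 0 < r → n (r • v) = n v) {g : ℝ → ℝ≥0∞} (hg : Measurable g) :
    ∫⁻ v, n v * g ‖v‖ ∂μ = (∫⁻ v : sphere (0 : E) 1, n v ∂μ.toSphere) *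
      ∫⁻ r, g r ∂(Measure.volumeIoiPow (Module.finrank ℝ E - 1)) := by
  rw [← lintegral_prod_mul (f := fun v : sphere (0 : E) 1 => n v)
      (g := fun r : Ioi (0 : ℝ) => g r) (aemeasurable_sphere_of_smul hn hhom) (by fun_prop),
    ← μ.measurePreserving_homeomorphUnitSphereProd.lintegral_comp_emb
      (homeomorphUnitSphereProd E).measurableEmbedding,
    ← restrict_compl_singleton (μ := μ) 0,
    ← lintegral_subtype_comap (measurableSet_singleton (0 : E)).compl,
    restrict_compl_singleton (μ := μ) 0]
  refine lintegral_congr fun v => ?_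
  have hv : 0 < ‖(v : E)‖⁻¹ := inv_pos.2 (norm_pos_iff.2 v.2)
  simp [hhom _ (v : E) hv]

end Polar

section GaussianWeight

open Matrix

/-- The density `exp (-|x|² / 2)` of the standard Gaussian measure, without its normalizing
constant. -/
def gaussWeight {ι : Type*} [Fintype ι] (x : ι → ℝ) : ℝ≥0∞ :=
  ENNReal.ofReal (Real.exp (-(1 / 2) * (x ⬝ᵥ x)))

/-- The density `exp (-⟨Q x, x⟩ / 2)` of the Gaussian measure of covariance `Q⁻¹`, without its
normalizing constant. -/
def quadWeight {ι : Type*} [Fintype ι] (Q : Matrix ι ι ℝ) (x : ι → ℝ) : ℝ≥0∞ :=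
  ENNReal.ofReal (Real.exp (-(1 / 2) * ((Q *ᵥ x) ⬝ᵥ x)))

variable {ι κ : Type*} [Fintype ι] [Fintype κ]

theorem continuous_gaussWeight : Continuous (gaussWeight : (ι → ℝ) → ℝ≥0∞) :=
  ENNReal.continuous_ofReal.comp (by fun_prop)

theorem continuous_quadWeight (Q : Matrix ι ι ℝ) : Continuous (quadWeight Q) :=
  ENNReal.continuous_ofReal.comp (by fun_prop)

theorem lintegral_gaussWeight :
    ∫⁻ x : ι → ℝ, gaussWeight x = ENNReal.ofReal (√(2 * Real.pi) ^ Fintype.card ι) := by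
  have hexp : ∀ x : ι → ℝ, gaussWeight x =
      ENNReal.ofReal (∏ i, Real.exp (-(1 / 2) * x i ^ 2)) := fun x => by
    rw [gaussWeight, ← Real.exp_sum, dotProduct, Finset.mul_sum]
    simp only [pow_two]
  have hint : Integrable fun x : ι → ℝ => ∏ i, Real.exp (-(1 / 2) * x i ^ 2) :=
    Integrable.fintype_prod (f := fun _ t => Real.exp (-(1 / 2) * t ^ 2))
      fun _ => integrable_exp_neg_mul_sq one_half_pos
  simp only [hexp]
  rw [← ofReal_integral_eq_lintegral_ofReal hint
    (Filter.Eventually.of_forall fun x => Finset.prod_nonneg fun i _ => (Real.exp_pos _).le),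
    integral_fintype_prod_volume_eq_pow (fun t : ℝ => Real.exp (-(1 / 2) * t ^ 2)),
    integral_gaussian, div_div_eq_mul_div, div_one, mul_comm Real.pi]

theorem lintegral_comp_mulVec [DecidableEq κ] {B : Matrix κ κ ℝ} (hB : B.det ≠ 0)
    {h : (κ → ℝ) → ℝ≥0∞} (hh : Measurable h) :
    ∫⁻ y, h (B *ᵥ y) = ENNReal.ofReal |B.det|⁻¹ * ∫⁻ y, h y := by
  have hBm : Measurable (toLin' B) := (toLin' B).continuous_of_finiteDimensional.measurable
  calc ∫⁻ y, h (B *ᵥ y) = ∫⁻ y, h y ∂(Measure.map (toLin' B) volume) :=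
        (lintegral_map hh hBm).symm
    _ = ENNReal.ofReal |B.det|⁻¹ * ∫⁻ y, h y := by
        rw [Real.map_matrix_volume_pi_eq_smul_volume_pi hB, lintegral_smul_measure, abs_inv,
          smul_eq_mul]

theorem exists_transpose_mul_self_eq {Q : Matrix κ κ ℝ} (hQ : Q.PosSemidef) :
    ∃ B : Matrix κ κ ℝ, Bᵀ * B = Q := by
  classical
  open scoped MatrixOrder Matrix.Norms.L2Operator in
  obtain ⟨B, hB⟩ := CStarAlgebra.nonneg_iff_eq_star_mul_self.1 hQ.nonneg
  exact ⟨B, hB.symm⟩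

theorem lintegral_quadWeight [DecidableEq κ] {Q : Matrix κ κ ℝ} (hQ : Q.PosDef) :
    ∫⁻ y, quadWeight Q y = ENNReal.ofReal ((√Q.det)⁻¹ * √(2 * Real.pi) ^ Fintype.card κ) := by
  obtain ⟨B, rfl⟩ := exists_transpose_mul_self_eq hQ.posSemidef
  have hdet : (Bᵀ * B).det = B.det * B.det := by rw [det_mul, det_transpose]
  have hB : B.det ≠ 0 := fun h => hQ.det_pos.ne' (by rw [hdet, h, zero_mul])
  have hq : ∀ y, quadWeight (Bᵀ * B) y = gaussWeight (B *ᵥ y) := fun y => by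
    rw [quadWeight, gaussWeight, ← mulVec_mulVec, mulVec_transpose, ← dotProduct_mulVec]
  simp only [hq]
  rw [lintegral_comp_mulVec hB continuous_gaussWeight.measurable, lintegral_gaussWeight,
    ← ENNReal.ofReal_mul (by positivity), hdet, Real.sqrt_mul_self_eq_abs]

end GaussianWeight

section GaussianFiber

open Matrix

theorem isFiniteMeasureOnCompacts_of_lintegral_ne_top {X : Type*} [TopologicalSpace X]
    [MeasurableSpace X] [OpensMeasurableSpace X] {ν : Measure X} {q : X → ℝ≥0∞}
    (hq : Continuous q) (hpos : ∀ x, q x ≠ 0) (hint : ∫⁻ x, q x ∂ν ≠ ∞) :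
    IsFiniteMeasureOnCompacts ν := by
  refine ⟨fun B hB => ?_⟩
  rcases B.eq_empty_or_nonempty with rfl | hne
  · simp
  obtain ⟨x₀, -, hmin⟩ := hB.exists_isMinOn hne hq.continuousOn
  have hle : q x₀ * ν B ≤ ∫⁻ x, q x ∂ν := by
    rw [← setLIntegral_const]
    exact (setLIntegral_mono hq.measurable hmin).trans (setLIntegral_le_lintegral _ _)
  exact ENNReal.lt_top_of_mul_ne_top_right (ne_top_of_le_ne_top hint hle) (hpos x₀)

variable {ι κ : Type*} [Fintype ι] [Fintype κ] [DecidableEq κ] {K : Matrix κ ι ℝ}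

/-- The coordinates, in the rows of a matrix `K` of full row rank, of the orthogonal projection of
`z` to the row space of `K`. -/
def rowCoord (K : Matrix κ ι ℝ) (z : ι → ℝ) : κ → ℝ := (K * Kᵀ)⁻¹ *ᵥ (K *ᵥ z)

/-- The orthogonal projection to the row space of a matrix of full row rank. -/
def rowProj (K : Matrix κ ι ℝ) : Matrix ι ι ℝ := Kᵀ * (K * Kᵀ)⁻¹ * K

/-- The factor in the coarea formula for a Gaussian integral: the Gaussian integral over a fiber of
`K`, divided by the Jacobian of `K`. -/
def fiberConst (K : Matrix κ ι ℝ) : ℝ :=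
  √(2 * Real.pi) ^ Fintype.card ι / (√(2 * Real.pi) ^ Fintype.card κ * √(K * Kᵀ).det)

/-- The image under `K` of the measure whose density at `z` is the Gaussian weight of the component
of `z` in the kernel of `K`. -/
def fiberMeasure (K : Matrix κ ι ℝ) : Measure (κ → ℝ) :=
  (volume.withDensity fun z => gaussWeight (z - rowProj K *ᵥ z)).map fun z => K *ᵥ z

theorem fiberConst_nonneg (K : Matrix κ ι ℝ) : 0 ≤ fiberConst K := by
  unfold fiberConst
  positivity

theorem continuous_gaussWeight_sub_rowProj (K : Matrix κ ι ℝ) :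
    Continuous fun z => gaussWeight (z - rowProj K *ᵥ z) :=
  continuous_gaussWeight.comp (by fun_prop)

theorem rowProj_mulVec (K : Matrix κ ι ℝ) (z : ι → ℝ) :
    rowProj K *ᵥ z = Kᵀ *ᵥ rowCoord K z := by
  simp only [rowProj, rowCoord, mulVec_mulVec, Matrix.mul_assoc]

theorem mul_transpose_mulVec_rowCoord (hK : (K * Kᵀ).PosDef) (z : ι → ℝ) :
    (K * Kᵀ) *ᵥ rowCoord K z = K *ᵥ z := by
  rw [rowCoord, mulVec_mulVec, mul_nonsing_inv _ hK.det_pos.ne'.isUnit, one_mulVec]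

theorem mulVec_rowProj (hK : (K * Kᵀ).PosDef) (z : ι → ℝ) :
    K *ᵥ (rowProj K *ᵥ z) = K *ᵥ z := by
  rw [rowProj_mulVec, mulVec_mulVec, mul_transpose_mulVec_rowCoord hK]

theorem rowCoord_transpose_mulVec (hK : (K * Kᵀ).PosDef) (y : κ → ℝ) :
    rowCoord K (Kᵀ *ᵥ y) = y := by
  rw [rowCoord, mulVec_mulVec _ K, mulVec_mulVec, nonsing_inv_mul _ hK.det_pos.ne'.isUnit,
    one_mulVec]

theorem dotProduct_self_eq_add_rowCoord (hK : (K * Kᵀ).PosDef) (z : ι → ℝ) :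
    z ⬝ᵥ z = (z - rowProj K *ᵥ z) ⬝ᵥ (z - rowProj K *ᵥ z) + rowCoord K z ⬝ᵥ (K *ᵥ z) := by
  have hcross : z ⬝ᵥ (Kᵀ *ᵥ rowCoord K z) = rowCoord K z ⬝ᵥ (K *ᵥ z) := by
    rw [dotProduct_mulVec, vecMul_transpose, dotProduct_comm]
  have hself : (Kᵀ *ᵥ rowCoord K z) ⬝ᵥ (Kᵀ *ᵥ rowCoord K z) = rowCoord K z ⬝ᵥ (K *ᵥ z) := by
    rw [dotProduct_mulVec, vecMul_transpose, mulVec_mulVec, mul_transpose_mulVec_rowCoord hK,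
      dotProduct_comm]
  rw [rowProj_mulVec]
  simp only [sub_dotProduct, dotProduct_sub, dotProduct_comm _ z, hcross, hself]
  ring

theorem gaussWeight_eq_mul_quadWeight (hK : (K * Kᵀ).PosDef) (z : ι → ℝ) :
    gaussWeight z = gaussWeight (z - rowProj K *ᵥ z) * quadWeight (K * Kᵀ)⁻¹ (K *ᵥ z) := by
  rw [gaussWeight, gaussWeight, quadWeight, ← ENNReal.ofReal_mul (Real.exp_pos _).le,
    ← Real.exp_add, ← mul_add, dotProduct_self_eq_add_rowCoord hK, rowCoord]

theorem lintegral_fiberMeasure (K : Matrix κ ι ℝ) {h : (κ → ℝ) → ℝ≥0∞} (hh : Measurable h) :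
    ∫⁻ y, h y ∂fiberMeasure K = ∫⁻ z, gaussWeight (z - rowProj K *ᵥ z) * h (K *ᵥ z) := by
  have hKm : Measurable fun z => K *ᵥ z := Continuous.measurable (by fun_prop)
  rw [fiberMeasure, lintegral_map hh hKm, lintegral_withDensity_eq_lintegral_mul
    (g := fun z => h (K *ᵥ z)) _ (continuous_gaussWeight_sub_rowProj K).measurable
    (hh.comp hKm)]
  rfl

theorem lintegral_quadWeight_fiberMeasure (hK : (K * Kᵀ).PosDef) :
    ∫⁻ y, quadWeight (K * Kᵀ)⁻¹ y ∂fiberMeasure K =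
      ENNReal.ofReal (√(2 * Real.pi) ^ Fintype.card ι) := by
  rw [lintegral_fiberMeasure K (continuous_quadWeight _).measurable, ← lintegral_gaussWeight]
  exact lintegral_congr fun z => (gaussWeight_eq_mul_quadWeight hK z).symm

theorem isAddLeftInvariant_fiberMeasure (hK : (K * Kᵀ).PosDef) :
    (fiberMeasure K).IsAddLeftInvariant := by
  refine ⟨fun y => ?_⟩
  ext s hs
  have hs' : MeasurableSet ((fun x => y + x) ⁻¹' s) := measurable_const_add y hs
  -- Translating by a vector of the row space does not change the component in the kernel.
  set z₀ := Kᵀ *ᵥ ((K * Kᵀ)⁻¹ *ᵥ y)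
  have hKz : K *ᵥ z₀ = y := by
    rw [mulVec_mulVec, mulVec_mulVec, mul_nonsing_inv _ hK.det_pos.ne'.isUnit, one_mulVec]
  have hPz : rowProj K *ᵥ z₀ = z₀ := by
    rw [rowProj_mulVec, rowCoord_transpose_mulVec hK]
  rw [Measure.map_apply (measurable_const_add y) hs, ← lintegral_indicator_one hs',
    ← lintegral_indicator_one hs, lintegral_fiberMeasure K (measurable_one.indicator hs'),
    lintegral_fiberMeasure K (measurable_one.indicator hs),
    ← lintegral_add_right_eq_self (fun z => _ * s.indicator 1 (K *ᵥ z)) z₀]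
  refine lintegral_congr fun z => ?_
  rw [mulVec_add, mulVec_add, hPz, hKz, add_sub_add_right_eq_sub, add_comm (K *ᵥ z)]
  rfl

theorem fiberMeasure_eq_smul (hK : (K * Kᵀ).PosDef) :
    fiberMeasure K = ENNReal.ofReal (fiberConst K) • volume := by
  have hinv := isAddLeftInvariant_fiberMeasure hK
  have hint := lintegral_quadWeight_fiberMeasure hK
  have hfin : IsFiniteMeasureOnCompacts (fiberMeasure K) :=
    isFiniteMeasureOnCompacts_of_lintegral_ne_top (continuous_quadWeight (K * Kᵀ)⁻¹)
      (fun y => (ENNReal.ofReal_pos.2 (Real.exp_pos _)).ne') (hint ▸ ENNReal.ofReal_ne_top)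
  have hsmul := Measure.isAddLeftInvariant_eq_smul (fiberMeasure K) volume
  set c := Measure.addHaarScalarFactor (fiberMeasure K) volume
  have hpos : 0 < (√(K * Kᵀ)⁻¹.det)⁻¹ * √(2 * Real.pi) ^ Fintype.card κ :=
    mul_pos (inv_pos.2 (Real.sqrt_pos.2 hK.inv.det_pos)) (by positivity)
  have hc : (c : ℝ≥0∞) = ENNReal.ofReal (fiberConst K) := by
    rw [hsmul, lintegral_smul_measure, lintegral_quadWeight hK.inv, ENNReal.smul_def,
      smul_eq_mul, mul_comm] at hint
    rw [(ENNReal.eq_div_iff (ENNReal.ofReal_pos.2 hpos).ne' ENNReal.ofReal_ne_top).2 hint,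
      ← ENNReal.ofReal_div_of_pos hpos, fiberConst, det_nonsing_inv, Ring.inverse_eq_inv',
      Real.sqrt_inv, inv_inv, mul_comm (√_)]
  rw [hsmul, ← hc]
  rfl

theorem lintegral_gaussWeight_sub_rowProj_mul (hK : (K * Kᵀ).PosDef) {h : (κ → ℝ) → ℝ≥0∞}
    (hh : Measurable h) :
    ∫⁻ z, gaussWeight (z - rowProj K *ᵥ z) * h (K *ᵥ z) =
      ENNReal.ofReal (fiberConst K) * ∫⁻ y, h y := by
  rw [← lintegral_fiberMeasure K hh, fiberMeasure_eq_smul hK, lintegral_smul_measure, smul_eq_mul]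

theorem lintegral_gaussWeight_mul_comp_mulVec (hK : (K * Kᵀ).PosDef) {h : (κ → ℝ) → ℝ≥0∞}
    (hh : Measurable h) :
    ∫⁻ z, gaussWeight z * h (K *ᵥ z) =
      ENNReal.ofReal (fiberConst K) * ∫⁻ y, quadWeight (K * Kᵀ)⁻¹ y * h y := by
  rw [← lintegral_gaussWeight_sub_rowProj_mul hK
    (h := fun y => quadWeight (K * Kᵀ)⁻¹ y * h y) ((continuous_quadWeight _).measurable.mul hh)]
  refine lintegral_congr fun z => ?_
  rw [← mul_assoc, ← gaussWeight_eq_mul_quadWeight hK]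

end GaussianFiber

section Twist

open Matrix

theorem hasFDerivAt_cos_mul_sub_sin_mul {W : Type*} [NormedAddCommGroup W] [NormedSpace ℝ W]
    {φ a u : W → ℝ} {φ' a' u' : W →L[ℝ] ℝ} {w : W} (hφ : HasFDerivAt φ φ' w)
    (ha : HasFDerivAt a a' w) (hu : HasFDerivAt u u' w) :
    HasFDerivAt (fun w => Real.cos (φ w) * a w - Real.sin (φ w) * u w)
      (Real.cos (φ w) • (a' - u w • φ') - Real.sin (φ w) • (u' + a w • φ')) w := by
  refine ((hφ.cos.mul ha).sub (hφ.sin.mul hu)).congr_fderiv ?_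
  module

theorem hasFDerivAt_sin_mul_add_cos_mul {W : Type*} [NormedAddCommGroup W] [NormedSpace ℝ W]
    {φ a u : W → ℝ} {φ' a' u' : W →L[ℝ] ℝ} {w : W} (hφ : HasFDerivAt φ φ' w)
    (ha : HasFDerivAt a a' w) (hu : HasFDerivAt u u' w) :
    HasFDerivAt (fun w => Real.sin (φ w) * a w + Real.cos (φ w) * u w)
      (Real.sin (φ w) • (a' - u w • φ') + Real.cos (φ w) • (u' + a w • φ')) w := by
  refine ((hφ.sin.mul ha).add (hφ.cos.mul hu)).congr_fderiv ?_
  module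

section Rotation

variable {ι : Type*} [DecidableEq ι]

/-- The matrix that rotates the plane of the coordinates `inl i` and `inr i` by the angle `φ i`. -/
def rotMatrix (φ : ι → ℝ) : Matrix (ι ⊕ ι) (ι ⊕ ι) ℝ :=
  fromBlocks (diagonal fun i => Real.cos (φ i)) (-diagonal fun i => Real.sin (φ i))
    (diagonal fun i => Real.sin (φ i)) (diagonal fun i => Real.cos (φ i))

theorem transpose_rotMatrix (φ : ι → ℝ) : (rotMatrix φ)ᵀ = rotMatrix (-φ) := by
  simp [rotMatrix, fromBlocks_transpose, ← diagonal_neg]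

variable [Fintype ι]

theorem rotMatrix_mulVec_inl (φ : ι → ℝ) (w : ι ⊕ ι → ℝ) (i : ι) :
    (rotMatrix φ *ᵥ w) (Sum.inl i) =
      Real.cos (φ i) * w (Sum.inl i) - Real.sin (φ i) * w (Sum.inr i) := by
  simp [rotMatrix, fromBlocks_mulVec, mulVec_diagonal, sub_eq_add_neg]

theorem rotMatrix_mulVec_inr (φ : ι → ℝ) (w : ι ⊕ ι → ℝ) (i : ι) :
    (rotMatrix φ *ᵥ w) (Sum.inr i) =
      Real.sin (φ i) * w (Sum.inl i) + Real.cos (φ i) * w (Sum.inr i) := by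
  simp [rotMatrix, fromBlocks_mulVec, mulVec_diagonal]

theorem rotMatrix_neg_mulVec_rotMatrix_mulVec (φ : ι → ℝ) (w : ι ⊕ ι → ℝ) :
    rotMatrix (-φ) *ᵥ (rotMatrix φ *ᵥ w) = w := by
  ext (i | i)
  · simp only [rotMatrix_mulVec_inl, rotMatrix_mulVec_inr, Pi.neg_apply, Real.cos_neg,
      Real.sin_neg]
    linear_combination w (Sum.inl i) * Real.sin_sq_add_cos_sq (φ i)
  · simp only [rotMatrix_mulVec_inl, rotMatrix_mulVec_inr, Pi.neg_apply, Real.cos_neg,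
      Real.sin_neg]
    linear_combination w (Sum.inr i) * Real.sin_sq_add_cos_sq (φ i)

theorem rotMatrix_neg_mul_self (φ : ι → ℝ) : rotMatrix (-φ) * rotMatrix φ = 1 := by
  refine Matrix.ext_of_mulVec_single fun i => ?_
  rw [← mulVec_mulVec, rotMatrix_neg_mulVec_rotMatrix_mulVec, one_mulVec]

theorem dotProduct_rotMatrix_mulVec_self (φ : ι → ℝ) (w : ι ⊕ ι → ℝ) :
    (rotMatrix φ *ᵥ w) ⬝ᵥ (rotMatrix φ *ᵥ w) = w ⬝ᵥ w := by
  rw [dotProduct_mulVec, ← mulVec_transpose, transpose_rotMatrix,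
    rotMatrix_neg_mulVec_rotMatrix_mulVec]

theorem abs_det_rotMatrix (φ : ι → ℝ) : |(rotMatrix φ).det| = 1 := by
  have hdet := congrArg Matrix.det (rotMatrix_neg_mul_self φ)
  rw [← transpose_rotMatrix, det_mul, det_transpose, det_one] at hdet
  exact abs_eq_abs.2 (by simpa using mul_self_eq_one_iff.1 hdet) |>.trans abs_one

end Rotation

theorem lintegral_comp_inl_mul_comp_inr {α β : Type*} [Fintype α] [Fintype β]
    {f : (α → ℝ) → ℝ≥0∞} {g : (β → ℝ) → ℝ≥0∞} (hf : Measurable f) (hg : Measurable g) :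
    ∫⁻ w : α ⊕ β → ℝ, f (w ∘ Sum.inl) * g (w ∘ Sum.inr) = (∫⁻ a, f a) * ∫⁻ z, g z := by
  rw [← lintegral_prod_mul hf.aemeasurable hg.aemeasurable]
  exact (volume_measurePreserving_sumPiEquivProdPi fun _ : α ⊕ β => ℝ).lintegral_comp_emb
    (MeasurableEquiv.measurableEmbedding _) (fun p => f p.1 * g p.2)

/-- The product of the intervals `[0, 2π)`, a fundamental domain of the torus. -/
def angleBox (κ : Type*) : Set (κ → ℝ) := Set.univ.pi fun _ => Set.Ico 0 (2 * Real.pi)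

theorem measurableSet_angleBox (κ : Type*) [Finite κ] : MeasurableSet (angleBox κ) :=
  MeasurableSet.univ_pi fun _ => measurableSet_Ico

theorem volume_angleBox (κ : Type*) [Fintype κ] :
    volume (angleBox κ) = ENNReal.ofReal ((2 * Real.pi) ^ Fintype.card κ) := by
  simp [angleBox, volume_pi_pi, ENNReal.ofReal_pow Real.two_pi_pos.le]

variable {ι κ : Type*} [Fintype ι] [Fintype κ] [DecidableEq κ]

theorem measurable_rowCoord (A : Matrix κ ι ℝ) : Measurable (rowCoord A) := by
  unfold rowCoord
  exact Continuous.measurable (by fun_prop)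

/-- A fundamental domain for the angles of `twist A`. -/
def twistDomain (A : Matrix κ ι ℝ) : Set (ι ⊕ ι → ℝ) :=
  {w | rowCoord A (w ∘ Sum.inr) ∈ angleBox κ}

theorem measurableSet_twistDomain (A : Matrix κ ι ℝ) : MeasurableSet (twistDomain A) :=
  ((measurable_rowCoord A).comp (by fun_prop)) (measurableSet_angleBox κ)

theorem lintegral_gaussWeight_sub_rowProj_mul_indicator {A : Matrix κ ι ℝ}
    (hA : (A * Aᵀ).PosDef) :
    ∫⁻ z, gaussWeight (z - rowProj A *ᵥ z) * (angleBox κ).indicator 1 (rowCoord A z) =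
      ENNReal.ofReal (fiberConst A * (2 * Real.pi) ^ Fintype.card κ) *
        ENNReal.ofReal (A * Aᵀ).det := by
  have hind : Measurable ((angleBox κ).indicator (1 : (κ → ℝ) → ℝ≥0∞)) :=
    measurable_one.indicator (measurableSet_angleBox κ)
  have hmul : Measurable fun y => (A * Aᵀ)⁻¹ *ᵥ y := Continuous.measurable (by fun_prop)
  simp only [rowCoord]
  rw [lintegral_gaussWeight_sub_rowProj_mul hA
      (h := fun y => (angleBox κ).indicator 1 ((A * Aᵀ)⁻¹ *ᵥ y)) (hind.comp hmul),
    lintegral_comp_mulVec hA.inv.det_pos.ne' hind,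
    lintegral_indicator_one (measurableSet_angleBox κ),
    volume_angleBox κ, det_nonsing_inv, Ring.inverse_eq_inv', abs_of_pos (inv_pos.2 hA.det_pos),
    inv_inv, ENNReal.ofReal_mul (fiberConst_nonneg A)]
  ring

variable [DecidableEq ι]

/-- A vector of `ℝ^ι × ℝ^ι` is written `(a, u + φ)` with `φ` in the row space and `u` in the kernel
of `A`, and is mapped to the rotation of `(a, u)` by the angles `φ`. This parametrizes the vectors
some rotation of which, by angles in the row space of `A`, has its second component in the kernel of
`A`. -/
def twist (A : Matrix κ ι ℝ) (w : ι ⊕ ι → ℝ) : ι ⊕ ι → ℝ :=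
  rotMatrix (rowProj A *ᵥ (w ∘ Sum.inr)) *ᵥ
    Sum.elim (w ∘ Sum.inl) (w ∘ Sum.inr - rowProj A *ᵥ (w ∘ Sum.inr))

/-- The Jacobian matrix of `twist A`. -/
def twistDeriv (A : Matrix κ ι ℝ) (w : ι ⊕ ι → ℝ) : Matrix (ι ⊕ ι) (ι ⊕ ι) ℝ :=
  rotMatrix (rowProj A *ᵥ (w ∘ Sum.inr)) *
    fromBlocks 1 (-(diagonal (w ∘ Sum.inr - rowProj A *ᵥ (w ∘ Sum.inr)) * rowProj A)) 0
      (1 - rowProj A + diagonal (w ∘ Sum.inl) * rowProj A)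

theorem gaussWeight_twist (A : Matrix κ ι ℝ) (w : ι ⊕ ι → ℝ) :
    gaussWeight (twist A w) = gaussWeight (w ∘ Sum.inl) *
      gaussWeight (w ∘ Sum.inr - rowProj A *ᵥ (w ∘ Sum.inr)) := by
  rw [gaussWeight, twist, dotProduct_rotMatrix_mulVec_self, sumElim_dotProduct_sumElim, mul_add,
    Real.exp_add, ENNReal.ofReal_mul (Real.exp_pos _).le]
  rfl

theorem twistDeriv_mulVec (A : Matrix κ ι ℝ) (w v : ι ⊕ ι → ℝ) :
    twistDeriv A w *ᵥ v = rotMatrix (rowProj A *ᵥ (w ∘ Sum.inr)) *ᵥ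
      Sum.elim
        (v ∘ Sum.inl - (w ∘ Sum.inr - rowProj A *ᵥ (w ∘ Sum.inr)) * (rowProj A *ᵥ (v ∘ Sum.inr)))
        (v ∘ Sum.inr - rowProj A *ᵥ (v ∘ Sum.inr) +
          w ∘ Sum.inl * (rowProj A *ᵥ (v ∘ Sum.inr))) := by
  have hdiag : ∀ x y : ι → ℝ, diagonal x *ᵥ y = x * y := fun x y =>
    funext (mulVec_diagonal x y)
  rw [twistDeriv, ← mulVec_mulVec, fromBlocks_mulVec, one_mulVec, neg_mulVec, zero_mulVec,
    zero_add, add_mulVec, sub_mulVec, one_mulVec, ← mulVec_mulVec, ← mulVec_mulVec, hdiag, hdiag,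
    ← sub_eq_add_neg]

theorem hasFDerivAt_twist (A : Matrix κ ι ℝ) (w : ι ⊕ ι → ℝ) :
    HasFDerivAt (twist A) (LinearMap.toContinuousLinearMap (toLin' (twistDeriv A w))) w := by
  have hcoord (k : ι ⊕ ι) :=
    (ContinuousLinearMap.proj (R := ℝ) (φ := fun _ : ι ⊕ ι => ℝ) k).hasFDerivAt (x := w)
  let φ (i : ι) : (ι ⊕ ι → ℝ) →L[ℝ] ℝ := LinearMap.toContinuousLinearMap
    (LinearMap.proj i ∘ₗ (rowProj A).mulVecLin ∘ₗ LinearMap.funLeft ℝ ℝ Sum.inr)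
  rw [hasFDerivAt_pi']
  rintro (i | i)
  · simp only [twist, rotMatrix_mulVec_inl]
    refine (hasFDerivAt_cos_mul_sub_sin_mul (φ i).hasFDerivAt (hcoord (Sum.inl i))
      ((hcoord (Sum.inr i)).sub (φ i).hasFDerivAt)).congr_fderiv ?_
    ext1 v
    exact ((congrFun (twistDeriv_mulVec A w v) (Sum.inl i)).trans
      (rotMatrix_mulVec_inl _ _ i)).symm
  · simp only [twist, rotMatrix_mulVec_inr]
    refine (hasFDerivAt_sin_mul_add_cos_mul (φ i).hasFDerivAt (hcoord (Sum.inl i))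
      ((hcoord (Sum.inr i)).sub (φ i).hasFDerivAt)).congr_fderiv ?_
    ext1 v
    exact ((congrFun (twistDeriv_mulVec A w v) (Sum.inr i)).trans
      (rotMatrix_mulVec_inr _ _ i)).symm

theorem continuous_twistDeriv (A : Matrix κ ι ℝ) : Continuous (twistDeriv A) := by
  unfold twistDeriv rotMatrix
  fun_prop

theorem abs_det_twistDeriv {A : Matrix κ ι ℝ} (hA : (A * Aᵀ).PosDef) (w : ι ⊕ ι → ℝ) :
    |(twistDeriv A w).det| = (A * Aᵀ).det⁻¹ * |(A * diagonal (w ∘ Sum.inl) * Aᵀ).det| := by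
  set D := diagonal (w ∘ Sum.inl)
  have hinv : A * Aᵀ * (A * Aᵀ)⁻¹ = 1 := mul_nonsing_inv _ hA.det_pos.ne'.isUnit
  have hblock : 1 - rowProj A + D * rowProj A = 1 + ((D - 1) * (Aᵀ * (A * Aᵀ)⁻¹)) * A := by
    rw [Matrix.mul_assoc, ← rowProj, Matrix.sub_mul, Matrix.one_mul]
    abel
  have hcomm : 1 + A * ((D - 1) * (Aᵀ * (A * Aᵀ)⁻¹)) = A * D * Aᵀ * (A * Aᵀ)⁻¹ := by
    rw [Matrix.sub_mul, Matrix.mul_sub, Matrix.one_mul, ← Matrix.mul_assoc A Aᵀ, hinv]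
    simp only [Matrix.mul_assoc]
    abel
  rw [twistDeriv, det_mul, abs_mul, abs_det_rotMatrix, one_mul, det_fromBlocks_zero₂₁, det_one,
    one_mul, hblock, det_one_add_mul_comm, hcomm, det_mul, abs_mul, det_nonsing_inv,
    Ring.inverse_eq_inv', abs_of_pos (inv_pos.2 hA.det_pos), mul_comm]

theorem aemeasurable_encard_twist_and_lintegral (A : Matrix κ ι ℝ) :
    AEMeasurable (fun y => ((twistDomain A ∩ twist A ⁻¹' {y}).encard : ℝ≥0∞)) ∧
      ∫⁻ y, ((twistDomain A ∩ twist A ⁻¹' {y}).encard : ℝ≥0∞) * gaussWeight y =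
        ∫⁻ w in twistDomain A, ENNReal.ofReal |(twistDeriv A w).det| * gaussWeight (twist A w) := by
  have hdet : Measurable fun w => (LinearMap.toContinuousLinearMap
      (toLin' (twistDeriv A w))).det := by
    simp only [LinearMap.det_toContinuousLinearMap, LinearMap.det_toLin']
    exact (continuous_twistDeriv A).matrix_det.measurable
  simpa only [LinearMap.det_toContinuousLinearMap, LinearMap.det_toLin'] using
    lintegral_encard_fiber volume (measurableSet_twistDomain A)
      (fun w _ => (hasFDerivAt_twist A w).hasFDerivWithinAt) hdet continuous_gaussWeight.measurable

theorem lintegral_encard_twist {A : Matrix κ ι ℝ} (hA : (A * Aᵀ).PosDef) :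
    ∫⁻ y, ((twistDomain A ∩ twist A ⁻¹' {y}).encard : ℝ≥0∞) * gaussWeight y =
      ENNReal.ofReal (fiberConst A * (2 * Real.pi) ^ Fintype.card κ) *
        ∫⁻ a : ι → ℝ, gaussWeight a * ENNReal.ofReal |(A * diagonal a * Aᵀ).det| := by
  let F : (ι → ℝ) → ℝ≥0∞ := fun a =>
    gaussWeight a * ENNReal.ofReal |(A * diagonal a * Aᵀ).det|
  let G : (ι → ℝ) → ℝ≥0∞ := fun z =>
    gaussWeight (z - rowProj A *ᵥ z) * (angleBox κ).indicator 1 (rowCoord A z)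
  have hF : Measurable F := continuous_gaussWeight.measurable.mul
    (Continuous.measurable (by fun_prop)).ennreal_ofReal
  have hG : Measurable G := (continuous_gaussWeight_sub_rowProj A).measurable.mul
    ((measurable_one.indicator (measurableSet_angleBox κ)).comp (measurable_rowCoord A))
  have hdet : ENNReal.ofReal (A * Aᵀ).det⁻¹ * ENNReal.ofReal (A * Aᵀ).det = 1 := by
    rw [← ENNReal.ofReal_mul (inv_pos.2 hA.det_pos).le, inv_mul_cancel₀ hA.det_pos.ne',
      ENNReal.ofReal_one]
  have hjac (w : ι ⊕ ι → ℝ) : (twistDomain A).indicator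
      (fun w => ENNReal.ofReal |(twistDeriv A w).det| * gaussWeight (twist A w)) w =
        ENNReal.ofReal (A * Aᵀ).det⁻¹ * (F (w ∘ Sum.inl) * G (w ∘ Sum.inr)) := by
    by_cases hw : rowCoord A (w ∘ Sum.inr) ∈ angleBox κ
    · rw [Set.indicator_of_mem (s := twistDomain A) hw, gaussWeight_twist, abs_det_twistDeriv hA,
        ENNReal.ofReal_mul (inv_pos.2 hA.det_pos).le]
      simp only [F, G, Set.indicator_of_mem hw, Pi.one_apply]
      ring
    · rw [Set.indicator_of_notMem (s := twistDomain A) hw]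
      simp only [G, Set.indicator_of_notMem hw, mul_zero]
  rw [(aemeasurable_encard_twist_and_lintegral A).2,
    ← lintegral_indicator (measurableSet_twistDomain A), lintegral_congr hjac,
    lintegral_const_mul _ (by fun_prop), lintegral_comp_inl_mul_comp_inr hF hG,
    lintegral_gaussWeight_sub_rowProj_mul_indicator hA]
  calc
    _ = ENNReal.ofReal (A * Aᵀ).det⁻¹ * ENNReal.ofReal (A * Aᵀ).det *
        (ENNReal.ofReal (fiberConst A * (2 * Real.pi) ^ Fintype.card κ) * ∫⁻ a, F a) := by ring
    _ = _ := by rw [hdet, one_mul]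

end Twist

section CircleFunctions

theorem circleCos_add_pi (a : AddCircle (2 * Real.pi)) :
    circleCos (a + (Real.pi : ℝ)) = -circleCos a := by
  obtain ⟨x, rfl⟩ := QuotientAddGroup.mk_surjective a
  exact Real.cos_add_pi x

theorem circleSin_add_pi (a : AddCircle (2 * Real.pi)) :
    circleSin (a + (Real.pi : ℝ)) = -circleSin a := by
  obtain ⟨x, rfl⟩ := QuotientAddGroup.mk_surjective a
  exact Real.sin_add_pi x

theorem circleCos_add (a b : AddCircle (2 * Real.pi)) :
    circleCos (a + b) = circleCos a * circleCos b - circleSin a * circleSin b := by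
  obtain ⟨x, rfl⟩ := QuotientAddGroup.mk_surjective a
  obtain ⟨y, rfl⟩ := QuotientAddGroup.mk_surjective b
  exact Real.cos_add x y

theorem circleCos_sub (a b : AddCircle (2 * Real.pi)) :
    circleCos (a - b) = circleCos a * circleCos b + circleSin a * circleSin b := by
  obtain ⟨x, rfl⟩ := QuotientAddGroup.mk_surjective a
  obtain ⟨y, rfl⟩ := QuotientAddGroup.mk_surjective b
  exact Real.cos_sub x y

theorem circleSin_add (a b : AddCircle (2 * Real.pi)) :
    circleSin (a + b) = circleSin a * circleCos b + circleCos a * circleSin b := by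
  obtain ⟨x, rfl⟩ := QuotientAddGroup.mk_surjective a
  obtain ⟨y, rfl⟩ := QuotientAddGroup.mk_surjective b
  exact Real.sin_add x y

theorem circleSin_sub (a b : AddCircle (2 * Real.pi)) :
    circleSin (a - b) = circleSin a * circleCos b - circleCos a * circleSin b := by
  obtain ⟨x, rfl⟩ := QuotientAddGroup.mk_surjective a
  obtain ⟨y, rfl⟩ := QuotientAddGroup.mk_surjective b
  exact Real.sin_sub x y

end CircleFunctions

section Phase

variable {L : ℕ}

/-- The angle `m₁θ₁ + ⋯ + m_Lθ_L`. -/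
def phase (m : Fin L → ℤ) (θ : Torus L) : AddCircle (2 * Real.pi) := ∑ j, m j • θ j

theorem continuous_phase (m : Fin L → ℤ) : Continuous (phase m) := by
  unfold phase
  fun_prop

theorem phase_add_right (m : Fin L → ℤ) (θ η : Torus L) :
    phase m (θ + η) = phase m θ + phase m η := by
  simp [phase, smul_add, Finset.sum_add_distrib]

theorem phase_add_left (m n : Fin L → ℤ) (θ : Torus L) :
    phase (m + n) θ = phase m θ + phase n θ := by
  simp [phase, add_smul, Finset.sum_add_distrib]

theorem phase_sub_left (m n : Fin L → ℤ) (θ : Torus L) :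
    phase (m - n) θ = phase m θ - phase n θ := by
  simp [phase, sub_smul, Finset.sum_sub_distrib]

theorem exists_phase_eq_pi {m : Fin L → ℤ} (hm : m ≠ 0) : ∃ η, phase m η = (Real.pi : ℝ) := by
  obtain ⟨i, hi⟩ := Function.ne_iff.1 hm
  have hi' : (m i : ℝ) ≠ 0 := Int.cast_ne_zero.2 hi
  refine ⟨Pi.single i ((Real.pi / m i : ℝ) : AddCircle (2 * Real.pi)), ?_⟩
  rw [phase, Finset.sum_eq_single i (fun j _ hj => by simp [hj]) (by simp), Pi.single_eq_same,
    ← AddCircle.coe_zsmul, zsmul_eq_mul, mul_div_cancel₀ _ hi']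

theorem integral_comp_phase_eq_zero {f : AddCircle (2 * Real.pi) → ℝ}
    (hf : ∀ a, f (a + (Real.pi : ℝ)) = -f a) {m : Fin L → ℤ} (hm : m ≠ 0) :
    ∫ θ : Torus L, f (phase m θ) = 0 := by
  obtain ⟨η, hη⟩ := exists_phase_eq_pi hm
  have hshift := integral_add_right_eq_self (μ := (volume : Measure (Torus L)))
    (fun θ => f (phase m θ)) η
  simp only [phase_add_right, hη, hf, integral_neg] at hshift
  linarith

theorem integrable_comp_phase {f : AddCircle (2 * Real.pi) → ℝ} (hf : Continuous f)
    (m : Fin L → ℤ) : Integrable fun θ : Torus L => f (phase m θ) :=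
  (hf.comp (continuous_phase m)).integrable_of_hasCompactSupport
    (HasCompactSupport.of_compactSpace _)

theorem integral_circleSin_phase (m : Fin L → ℤ) : ∫ θ : Torus L, circleSin (phase m θ) = 0 := by
  by_cases hm : m = 0
  · have hsin : circleSin 0 = 0 := Real.sin_zero
    simp [hm, phase, hsin]
  · exact integral_comp_phase_eq_zero circleSin_add_pi hm

theorem measureReal_univ_torus :
    (volume : Measure (Torus L)).real Set.univ = (2 * Real.pi) ^ L := by
  simp [Measure.real, volume_pi, Measure.pi_univ, AddCircle.measure_univ, Real.pi_pos.le]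

theorem integral_circleCos_phase (m : Fin L → ℤ) :
    ∫ θ : Torus L, circleCos (phase m θ) = if m = 0 then (2 * Real.pi) ^ L else 0 := by
  split_ifs with hm
  · have hcos : circleCos 0 = 1 := Real.cos_zero
    simp [hm, phase, hcos, measureReal_univ_torus]
  · exact integral_comp_phase_eq_zero circleCos_add_pi hm

end Phase

section L2Inner

variable {L : ℕ}

/-- The common value of the factors `p(m)`, `m ≠ 0`. -/
def trigScale (L : ℕ) : ℝ := √2 / (2 * Real.pi) ^ ((L : ℝ) / 2)

theorem trigScale_pos (L : ℕ) : 0 < trigScale L := by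
  unfold trigScale
  positivity

theorem trigScale_sq (L : ℕ) : trigScale L ^ 2 = 2 / (2 * Real.pi) ^ L := by
  rw [trigScale, div_pow, Real.sq_sqrt zero_le_two, ← Real.rpow_mul_natCast Real.two_pi_pos.le,
    Nat.cast_ofNat, div_mul_cancel₀ _ two_ne_zero, Real.rpow_natCast]

theorem trigScale_sq_mul (L : ℕ) : trigScale L ^ 2 * (1 / 2 * (2 * Real.pi) ^ L) = 1 := by
  rw [trigScale_sq]
  field_simp

theorem normFactor_of_mem {m : Fin L → ℤ} (hm : m ∈ posCone L) : normFactor m = trigScale L := by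
  rw [normFactor, if_neg (posCone_ne_zero hm), trigScale]

theorem cosFun_apply {m : Fin L → ℤ} (hm : m ∈ posCone L) (θ : Torus L) :
    cosFun m θ = trigScale L * circleCos (phase m θ) := by
  rw [← normFactor_of_mem hm]
  rfl

theorem sinFun_apply {m : Fin L → ℤ} (hm : m ∈ posCone L) (θ : Torus L) :
    sinFun m θ = trigScale L * circleSin (phase m θ) := by
  rw [← normFactor_of_mem hm]
  rfl

theorem posCone_add_ne_zero {m n : Fin L → ℤ} (hm : m ∈ posCone L) (hn : n ∈ posCone L) :
    m + n ≠ 0 := fun h => posCone_not_neg hm (by rwa [neg_eq_of_add_eq_zero_right h])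

theorem l2Inner_cosFun_cosFun {m n : Fin L → ℤ} (hm : m ∈ posCone L) (hn : n ∈ posCone L) :
    l2Inner (cosFun m) (cosFun n) = if m = n then 1 else 0 := by
  have hprod (θ : Torus L) : cosFun m θ * cosFun n θ = trigScale L ^ 2 * (1 / 2 *
      (circleCos (phase (m - n) θ) + circleCos (phase (m + n) θ))) := by
    rw [cosFun_apply hm, cosFun_apply hn, phase_sub_left, phase_add_left, circleCos_sub,
      circleCos_add]
    ring
  simp only [l2Inner, hprod]
  rw [integral_const_mul, integral_const_mul,
    integral_add (integrable_comp_phase continuous_circleCos _)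
      (integrable_comp_phase continuous_circleCos _),
    integral_circleCos_phase, integral_circleCos_phase, if_neg (posCone_add_ne_zero hm hn),
    add_zero]
  simp only [sub_eq_zero, mul_ite, mul_zero, trigScale_sq_mul]

theorem l2Inner_sinFun_sinFun {m n : Fin L → ℤ} (hm : m ∈ posCone L) (hn : n ∈ posCone L) :
    l2Inner (sinFun m) (sinFun n) = if m = n then 1 else 0 := by
  have hprod (θ : Torus L) : sinFun m θ * sinFun n θ = trigScale L ^ 2 * (1 / 2 *
      (circleCos (phase (m - n) θ) - circleCos (phase (m + n) θ))) := by
    rw [sinFun_apply hm, sinFun_apply hn, phase_sub_left, phase_add_left, circleCos_sub,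
      circleCos_add]
    ring
  simp only [l2Inner, hprod]
  rw [integral_const_mul, integral_const_mul,
    integral_sub (integrable_comp_phase continuous_circleCos _)
      (integrable_comp_phase continuous_circleCos _),
    integral_circleCos_phase, integral_circleCos_phase, if_neg (posCone_add_ne_zero hm hn),
    sub_zero]
  simp only [sub_eq_zero, mul_ite, mul_zero, trigScale_sq_mul]

theorem l2Inner_sinFun_cosFun {m n : Fin L → ℤ} (hm : m ∈ posCone L) (hn : n ∈ posCone L) :
    l2Inner (sinFun m) (cosFun n) = 0 := by
  have hprod (θ : Torus L) : sinFun m θ * cosFun n θ = trigScale L ^ 2 * (1 / 2 *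
      (circleSin (phase (m - n) θ) + circleSin (phase (m + n) θ))) := by
    rw [sinFun_apply hm, cosFun_apply hn, phase_sub_left, phase_add_left, circleSin_sub,
      circleSin_add]
    ring
  simp only [l2Inner, hprod]
  rw [integral_const_mul, integral_const_mul,
    integral_add (integrable_comp_phase continuous_circleSin _)
      (integrable_comp_phase continuous_circleSin _),
    integral_circleSin_phase, integral_circleSin_phase, add_zero, mul_zero, mul_zero]

theorem l2Inner_comm (f g : C(Torus L, ℝ)) : l2Inner f g = l2Inner g f := by
  simp only [l2Inner, mul_comm]

end L2Inner

section TrigPolynomials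

variable {L : ℕ} (M : Finset (Fin L → ℤ))

/-- The functions `A_m`, indexed by `inl m`, and `B_m`, indexed by `inr m`, with `m ∈ M`. -/
def trigFamily : M ⊕ M → C(Torus L, ℝ) :=
  Sum.elim (fun m => cosFun m.1) fun m => sinFun m.1

theorem span_range_trigFamily : Submodule.span ℝ (Set.range (trigFamily M)) = trigSpace M := by
  rw [trigFamily, Set.Sum.elim_range, trigSpace, Set.image_eq_range, Set.image_eq_range]
  rfl

/-- The trigonometric polynomial with given coefficients with respect to `trigFamily`. -/
def trigFun (w : M ⊕ M → ℝ) : C(Torus L, ℝ) := ∑ k, w k • trigFamily M k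

/-- The functions `A_m` and `B_m`, `m ∈ M`, as elements of the space they span. -/
def trigVec (k : M ⊕ M) : L2Space (trigSpace M) :=
  show trigSpace M from
    ⟨trigFamily M k, span_range_trigFamily M ▸ Submodule.subset_span (Set.mem_range_self k)⟩

/-- `L2Space.toFun` as a linear map. -/
def toFunLinear (V : Submodule ℝ C(Torus L, ℝ)) : L2Space V →ₗ[ℝ] C(Torus L, ℝ) := V.subtype

variable {M}

theorem mem_trigSpace_iff (v : C(Torus L, ℝ)) : v ∈ trigSpace M ↔ ∃ w, trigFun M w = v := by
  rw [← span_range_trigFamily, Submodule.mem_span_range_iff_exists_fun]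
  rfl

theorem toFun_sum_smul_trigVec (w : M ⊕ M → ℝ) :
    (∑ k, w k • trigVec M k).toFun = trigFun M w := by
  change toFunLinear (trigSpace M) _ = _
  simp only [map_sum, map_smul]
  rfl

theorem orthonormal_trigVec (hM : ∀ m ∈ M, m ∈ posCone L) : Orthonormal ℝ (trigVec M) := by
  classical
  rw [orthonormal_iff_ite]
  rintro (⟨m, hm⟩ | ⟨m, hm⟩) (⟨n, hn⟩ | ⟨n, hn⟩)
  · exact (l2Inner_cosFun_cosFun (hM m hm) (hM n hn)).trans (by simp)
  · exact (l2Inner_comm _ _).trans ((l2Inner_sinFun_cosFun (hM n hn) (hM m hm)).trans (by simp))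
  · exact (l2Inner_sinFun_cosFun (hM m hm) (hM n hn)).trans (by simp)
  · exact (l2Inner_sinFun_sinFun (hM m hm) (hM n hn)).trans (by simp)

theorem span_range_trigVec : ⊤ ≤ Submodule.span ℝ (Set.range (trigVec M)) := by
  intro v _
  obtain ⟨w, hw⟩ := (mem_trigSpace_iff v.toFun).1 (show trigSpace M from v).2
  refine (Submodule.mem_span_range_iff_exists_fun ℝ).2 ⟨w, ?_⟩
  exact Subtype.ext ((toFun_sum_smul_trigVec w).trans hw)

/-- The orthonormal basis of `V(M)` formed by the functions `A_m` and `B_m`. -/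
def trigBasis (hM : ∀ m ∈ M, m ∈ posCone L) :
    OrthonormalBasis (M ⊕ M) ℝ (L2Space (trigSpace M)) :=
  OrthonormalBasis.mk (orthonormal_trigVec hM) span_range_trigVec

theorem toFun_trigBasis_repr_symm (hM : ∀ m ∈ M, m ∈ posCone L) (w : EuclideanSpace ℝ (M ⊕ M)) :
    ((trigBasis hM).repr.symm w).toFun = trigFun M w := by
  rw [← (trigBasis hM).sum_repr_symm, trigBasis, OrthonormalBasis.coe_mk, toFun_sum_smul_trigVec]

end TrigPolynomials

section TwistFiber

open Matrix

variable {ι κ : Type*} [Fintype ι] [Fintype κ] [DecidableEq ι]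

/-- The second component of the rotation of `w` by the angles `-Aᵀ y`. If the columns of `A` are the
frequencies of a trigonometric polynomial with coefficients `w`, these numbers are the coefficients
of its differential at the point with angular coordinates `y`, as a combination of the frequencies,
up to the normalizing factor. -/
def diffCoef (A : Matrix κ ι ℝ) (w : ι ⊕ ι → ℝ) (y : κ → ℝ) : ι → ℝ :=
  (rotMatrix (-(Aᵀ *ᵥ y)) *ᵥ w) ∘ Sum.inr

theorem diffCoef_rotMatrix_mulVec (A : Matrix κ ι ℝ) (y : κ → ℝ) (a u : ι → ℝ) :
    diffCoef A (rotMatrix (Aᵀ *ᵥ y) *ᵥ Sum.elim a u) y = u := by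
  rw [diffCoef, rotMatrix_neg_mulVec_rotMatrix_mulVec, Sum.elim_comp_inr]

variable [DecidableEq κ] {A : Matrix κ ι ℝ}

theorem rotMatrix_neg_mulVec_twist (z : ι ⊕ ι → ℝ) :
    rotMatrix (-(Aᵀ *ᵥ rowCoord A (z ∘ Sum.inr))) *ᵥ twist A z =
      Sum.elim (z ∘ Sum.inl) (z ∘ Sum.inr - Aᵀ *ᵥ rowCoord A (z ∘ Sum.inr)) := by
  rw [twist, rowProj_mulVec, rotMatrix_neg_mulVec_rotMatrix_mulVec]

theorem mulVec_diffCoef_twist (hA : (A * Aᵀ).PosDef) (z : ι ⊕ ι → ℝ) :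
    A *ᵥ diffCoef A (twist A z) (rowCoord A (z ∘ Sum.inr)) = 0 := by
  rw [diffCoef, rotMatrix_neg_mulVec_twist, Sum.elim_comp_inr, mulVec_sub, ← rowProj_mulVec,
    mulVec_rowProj hA, sub_self]

theorem exists_twist_eq (hA : (A * Aᵀ).PosDef) {w : ι ⊕ ι → ℝ} {y : κ → ℝ}
    (hy : A *ᵥ diffCoef A w y = 0) : ∃ z, twist A z = w ∧ rowCoord A (z ∘ Sum.inr) = y := by
  set v := rotMatrix (-(Aᵀ *ᵥ y)) *ᵥ w with hv
  have hcoord : rowCoord A (v ∘ Sum.inr + Aᵀ *ᵥ y) = y := by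
    rw [rowCoord, mulVec_add, show A *ᵥ (v ∘ Sum.inr) = 0 from hy, zero_add]
    exact rowCoord_transpose_mulVec hA y
  refine ⟨Sum.elim (v ∘ Sum.inl) (v ∘ Sum.inr + Aᵀ *ᵥ y), ?_, hcoord⟩
  rw [twist, Sum.elim_comp_inr, Sum.elim_comp_inl, rowProj_mulVec, hcoord, add_sub_cancel_right,
    Sum.elim_comp_inl_inr, hv]
  simpa only [neg_neg] using rotMatrix_neg_mulVec_rotMatrix_mulVec (-(Aᵀ *ᵥ y)) w

theorem eq_of_twist_eq {z z' : ι ⊕ ι → ℝ} (htwist : twist A z = twist A z')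
    (hcoord : rowCoord A (z ∘ Sum.inr) = rowCoord A (z' ∘ Sum.inr)) : z = z' := by
  have helim := rotMatrix_neg_mulVec_twist (A := A) z
  rw [htwist, hcoord, rotMatrix_neg_mulVec_twist] at helim
  have hinl := congrArg (· ∘ Sum.inl) helim
  have hinr := congrArg (· ∘ Sum.inr) helim
  simp only [Sum.elim_comp_inl, Sum.elim_comp_inr, sub_left_inj] at hinl hinr
  rw [← Sum.elim_comp_inl_inr z, ← Sum.elim_comp_inl_inr z', hinl, hinr]

theorem encard_twist_fiber (hA : (A * Aᵀ).PosDef) (w : ι ⊕ ι → ℝ) :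
    (twistDomain A ∩ twist A ⁻¹' {w}).encard =
      (angleBox κ ∩ {y | A *ᵥ diffCoef A w y = 0}).encard := by
  have himage : (fun z => rowCoord A (z ∘ Sum.inr)) '' (twistDomain A ∩ twist A ⁻¹' {w}) =
      angleBox κ ∩ {y | A *ᵥ diffCoef A w y = 0} := by
    ext y
    constructor
    · rintro ⟨z, ⟨hz, rfl⟩, rfl⟩
      exact ⟨hz, mulVec_diffCoef_twist hA z⟩
    · rintro ⟨hbox, hy⟩
      obtain ⟨z, rfl, rfl⟩ := exists_twist_eq hA hy
      exact ⟨z, ⟨hbox, rfl⟩, rfl⟩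
  rw [← himage, Set.InjOn.encard_image]
  rintro z ⟨-, hz⟩ z' ⟨-, hz'⟩ hcoord
  exact eq_of_twist_eq (Eq.trans hz (Eq.symm hz')) hcoord

end TwistFiber

section CriticalPoints

open Matrix

variable {L : ℕ}

theorem phase_proj (m : Fin L → ℤ) (y : EuclideanSpace ℝ (Fin L)) :
    phase m (proj y) = ((∑ j, (m j : ℝ) * y j : ℝ) : AddCircle (2 * Real.pi)) := by
  refine Eq.trans ?_ (map_sum (QuotientAddGroup.mk' (AddSubgroup.zmultiples (2 * Real.pi)))
    (fun j => (m j : ℝ) * y j) Finset.univ).symm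
  exact Finset.sum_congr rfl fun j _ => zsmul_eq_mul (y j) (m j) ▸ rfl

theorem exists_mem_angleBox_proj_eq (x : Torus L) :
    ∃ y ∈ angleBox (Fin L), proj (WithLp.toLp 2 y) = x := by
  have hcoord (j : Fin L) : ∃ t ∈ Set.Ico 0 (2 * Real.pi), (t : AddCircle (2 * Real.pi)) = x j := by
    have himage := AddCircle.coe_image_Ico_eq (2 * Real.pi) 0
    rw [zero_add] at himage
    exact Set.eq_univ_iff_forall.1 himage (x j)
  choose y hy hyx using hcoord
  exact ⟨y, fun j _ => hy j, funext hyx⟩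

theorem injOn_proj_angleBox :
    Set.InjOn (fun y => proj (WithLp.toLp 2 y) : (Fin L → ℝ) → Torus L) (angleBox (Fin L)) := by
  intro y hy z hz h
  rw [angleBox, ← zero_add (2 * Real.pi)] at hy hz
  exact funext fun j =>
    (AddCircle.coe_eq_coe_iff_of_mem_Ico (hy j trivial) (hz j trivial)).1 (congrFun h j)

variable (M : Finset (Fin L → ℤ))

/-- The matrix whose columns are the frequencies. -/
def freqMatrix : Matrix (Fin L) M ℝ := Matrix.of fun j m => (m.1 j : ℝ)

theorem freqMatrix_transpose_mulVec (y : Fin L → ℝ) (m : M) :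
    ((freqMatrix M)ᵀ *ᵥ y) m = ∑ j, (m.1 j : ℝ) * y j := rfl

variable {M}

theorem trigFun_proj (hM : ∀ m ∈ M, m ∈ posCone L) (w : M ⊕ M → ℝ)
    (y : EuclideanSpace ℝ (Fin L)) :
    trigFun M w (proj y) = trigScale L * ∑ m,
      (Real.cos (((freqMatrix M)ᵀ *ᵥ y) m) * w (Sum.inl m) +
        Real.sin (((freqMatrix M)ᵀ *ᵥ y) m) * w (Sum.inr m)) := by
  simp only [trigFun, trigFamily, Fintype.sum_sum_type, Sum.elim_inl, Sum.elim_inr,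
    ContinuousMap.add_apply, ContinuousMap.sum_apply, ContinuousMap.smul_apply, smul_eq_mul,
    ← Finset.sum_add_distrib, Finset.mul_sum]
  refine Finset.sum_congr rfl fun m _ => ?_
  rw [cosFun_apply (hM m.1 m.2), sinFun_apply (hM m.1 m.2), phase_proj,
    freqMatrix_transpose_mulVec]
  change _ * (_ * Real.cos _) + _ * (_ * Real.sin _) = _
  ring

theorem hasFDerivAt_freqMatrix_transpose_mulVec (y : EuclideanSpace ℝ (Fin L)) (m : M) :
    HasFDerivAt (fun t : EuclideanSpace ℝ (Fin L) => ((freqMatrix M)ᵀ *ᵥ (y + t)) m)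
      (InnerProductSpace.toDual ℝ _ (WithLp.toLp 2 ((freqMatrix M).col m))) 0 := by
  have hlin (t : EuclideanSpace ℝ (Fin L)) : ((freqMatrix M)ᵀ *ᵥ (y + t)) m =
      ((freqMatrix M)ᵀ *ᵥ y) m +
        InnerProductSpace.toDual ℝ _ (WithLp.toLp 2 ((freqMatrix M).col m)) t := by
    rw [mulVec_add, Pi.add_apply, InnerProductSpace.toDual_apply_apply, PiLp.inner_apply]
    simp [mulVec, dotProduct, mul_comm]
  simp only [hlin]
  exact (ContinuousLinearMap.hasFDerivAt _).const_add _

theorem hasDifferentialAt_trigFun (hM : ∀ m ∈ M, m ∈ posCone L) (w : M ⊕ M → ℝ)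
    (y : Fin L → ℝ) :
    HasDifferentialAt (trigFun M w) (InnerProductSpace.toDual ℝ _
        (WithLp.toLp 2 (trigScale L • (freqMatrix M *ᵥ diffCoef (freqMatrix M) w y))))
      (proj (WithLp.toLp 2 y)) := by
  have htranslate (t : EuclideanSpace ℝ (Fin L)) :
      trigFun M w (proj (WithLp.toLp 2 y) + proj t) = trigFun M w (proj (WithLp.toLp 2 y + t)) :=
    rfl
  have hphase := hasFDerivAt_freqMatrix_transpose_mulVec (M := M) (WithLp.toLp 2 y)
  simp only [HasDifferentialAt, htranslate, trigFun_proj hM]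
  refine ((HasFDerivAt.fun_sum fun m _ => ((hphase m).cos.mul_const _).add
    ((hphase m).sin.mul_const _)).const_mul _).congr_fderiv ?_
  have hsum (c : M → ℝ) : InnerProductSpace.toDual ℝ (EuclideanSpace ℝ (Fin L))
      (WithLp.toLp 2 (trigScale L • (freqMatrix M *ᵥ c))) = trigScale L •
        ∑ m, c m • InnerProductSpace.toDual ℝ _ (WithLp.toLp 2 ((freqMatrix M).col m)) := by
    simp only [mulVec_eq_sum, op_smul_eq_smul, WithLp.toLp_smul, WithLp.toLp_sum, map_smul,
      map_sum]
    rfl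
  rw [hsum]
  refine congrArg _ (Finset.sum_congr rfl fun m _ => ?_)
  simp only [diffCoef, Function.comp_apply, rotMatrix_mulVec_inr, Pi.neg_apply, Real.cos_neg,
    Real.sin_neg, WithLp.ofLp_zero, add_zero]
  module

theorem hasDifferentialAt_trigFun_iff (hM : ∀ m ∈ M, m ∈ posCone L) (w : M ⊕ M → ℝ)
    (y : Fin L → ℝ) (ξ : EuclideanSpace ℝ (Fin L)) :
    HasDifferentialAt (trigFun M w) (InnerProductSpace.toDual ℝ _ ξ) (proj (WithLp.toLp 2 y)) ↔
      trigScale L • (freqMatrix M *ᵥ diffCoef (freqMatrix M) w y) = ξ.ofLp := by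
  have hdiff := hasDifferentialAt_trigFun hM w y
  constructor
  · intro hξ
    rw [(InnerProductSpace.toDual ℝ _).injective (HasFDerivAt.unique hξ hdiff)]
  · intro hξ
    rwa [hξ] at hdiff

theorem mem_criticalSet_trigFun_iff (hM : ∀ m ∈ M, m ∈ posCone L) (w : M ⊕ M → ℝ)
    (y : Fin L → ℝ) : proj (WithLp.toLp 2 y) ∈ criticalSet (trigFun M w) ↔
      freqMatrix M *ᵥ diffCoef (freqMatrix M) w y = 0 := by
  have hzero := hasDifferentialAt_trigFun_iff hM w y 0
  rwa [map_zero, WithLp.ofLp_zero, smul_eq_zero_iff_right (trigScale_pos L).ne'] at hzero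

theorem isAmple_trigSpace_iff (hM : ∀ m ∈ M, m ∈ posCone L) :
    IsAmple (trigSpace M) ↔ Function.Surjective (freqMatrix M).mulVec := by
  constructor
  · intro hample v
    obtain ⟨f, hf, hd⟩ := hample (proj (WithLp.toLp 2 0))
      (InnerProductSpace.toDual ℝ _ (WithLp.toLp 2 (trigScale L • v)))
    obtain ⟨w, rfl⟩ := (mem_trigSpace_iff f).1 hf
    rw [hasDifferentialAt_trigFun_iff hM] at hd
    exact ⟨_, smul_right_injective _ (trigScale_pos L).ne' hd⟩
  · intro hsurj x ξ
    obtain ⟨y, -, rfl⟩ := exists_mem_angleBox_proj_eq x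
    obtain ⟨ξ, rfl⟩ := (InnerProductSpace.toDual ℝ _).surjective ξ
    obtain ⟨u, hu : freqMatrix M *ᵥ u = _⟩ := hsurj ((trigScale L)⁻¹ • ξ.ofLp)
    refine ⟨trigFun M (rotMatrix ((freqMatrix M)ᵀ *ᵥ y) *ᵥ Sum.elim 0 u),
      (mem_trigSpace_iff _).2 ⟨_, rfl⟩, ?_⟩
    rw [hasDifferentialAt_trigFun_iff hM, diffCoef_rotMatrix_mulVec, hu,
      smul_inv_smul₀ (trigScale_pos L).ne']

theorem encard_criticalSet_trigFun (hM : ∀ m ∈ M, m ∈ posCone L)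
    (hA : (freqMatrix M * (freqMatrix M)ᵀ).PosDef) (w : M ⊕ M → ℝ) :
    (criticalSet (trigFun M w)).encard =
      (twistDomain (freqMatrix M) ∩ twist (freqMatrix M) ⁻¹' {w}).encard := by
  have himage : (fun y => proj (WithLp.toLp 2 y)) ''
      (angleBox (Fin L) ∩ {y | freqMatrix M *ᵥ diffCoef (freqMatrix M) w y = 0}) =
        criticalSet (trigFun M w) := by
    ext x
    constructor
    · rintro ⟨y, ⟨-, hy⟩, rfl⟩
      exact (mem_criticalSet_trigFun_iff hM w y).2 hy
    · intro hx
      obtain ⟨y, hbox, rfl⟩ := exists_mem_angleBox_proj_eq x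
      exact ⟨y, ⟨hbox, (mem_criticalSet_trigFun_iff hM w y).1 hx⟩, rfl⟩
  rw [encard_twist_fiber hA, ← himage,
    (injOn_proj_angleBox.mono Set.inter_subset_left).encard_image]

end CriticalPoints

section OrthonormalCoordinates

variable {ι E : Type*} [Fintype ι] [NormedAddCommGroup E] [InnerProductSpace ℝ E]

theorem gaussWeight_ofLp_repr (b : OrthonormalBasis ι ℝ E) (v : E) :
    gaussWeight (b.repr v).ofLp = ENNReal.ofReal (Real.exp (-(1 / 2) * ‖v‖ ^ 2)) := by
  rw [gaussWeight, ← b.repr.norm_map, EuclideanSpace.norm_sq_eq]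
  simp only [dotProduct, Real.norm_eq_abs, sq_abs, ← pow_two]

variable [FiniteDimensional ℝ E] [MeasurableSpace E] [BorelSpace E]

theorem measurePreserving_ofLp_repr (b : OrthonormalBasis ι ℝ E) :
    MeasurePreserving fun v : E => (b.repr v).ofLp :=
  (PiLp.volume_preserving_ofLp ι).comp b.measurePreserving_repr

theorem lintegral_comp_ofLp_repr (b : OrthonormalBasis ι ℝ E) (h : (ι → ℝ) → ℝ≥0∞) :
    ∫⁻ v : E, h (b.repr v).ofLp = ∫⁻ w, h w :=
  (measurePreserving_ofLp_repr b).lintegral_comp_emb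
    ((MeasurableEquiv.toLp 2 (ι → ℝ)).symm.measurableEmbedding.comp
      b.repr.toHomeomorph.measurableEmbedding) h

end OrthonormalCoordinates

section SphereAverage

variable {L : ℕ}

theorem criticalSet_smul {r : ℝ} (hr : r ≠ 0) (f : C(Torus L, ℝ)) :
    criticalSet (r • f : C(Torus L, ℝ)) = criticalSet f := by
  have hsub (s : ℝ) (g : C(Torus L, ℝ)) :
      criticalSet g ⊆ criticalSet (s • g : C(Torus L, ℝ)) := fun x hx => by
    have hsmul := HasFDerivAt.const_smul (show HasFDerivAt _ _ _ from hx) s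
    rwa [smul_zero] at hsmul
  refine Set.Subset.antisymm ?_ (hsub r f)
  simpa only [inv_smul_smul₀ hr] using hsub r⁻¹ (r • f)

theorem expectedCritical_mul_lintegral (V : Submodule ℝ C(Torus L, ℝ)) [FiniteDimensional ℝ V]
    [Nontrivial (L2Space V)]
    (hmeas : AEMeasurable fun v : L2Space V => ((criticalSet v.toFun).encard : ℝ≥0∞))
    {g : ℝ → ℝ≥0∞} (hg : Measurable g) :
    expectedCritical V * ∫⁻ v : L2Space V, g ‖v‖ =
      ∫⁻ v : L2Space V, ((criticalSet v.toFun).encard : ℝ≥0∞) * g ‖v‖ := by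
  have hsphere : (volume : Measure (L2Space V)).toSphere Set.univ ≠ 0 := by
    simpa only [ne_eq, Measure.measure_univ_eq_zero] using Measure.toSphere_ne_zero volume
  have hhom (r : ℝ) (v : L2Space V) (hr : 0 < r) :
      ((criticalSet (r • v).toFun).encard : ℝ≥0∞) = (criticalSet v.toFun).encard := by
    rw [show (r • v).toFun = r • v.toFun from rfl, criticalSet_smul hr.ne']
  have hradial := lintegral_mul_fun_norm_eq (μ := (volume : Measure (L2Space V))) (n := fun _ => 1)
    aemeasurable_const (fun _ _ _ => rfl) hg
  simp only [one_mul, lintegral_one] at hradial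
  rw [lintegral_mul_fun_norm_eq hmeas hhom hg, hradial, expectedCritical, ← mul_assoc,
    ENNReal.div_mul_cancel hsphere (measure_ne_top _ _)]

end SphereAverage

section GaussianAverage

variable {L : ℕ} {M : Finset (Fin L → ℤ)}

theorem trigFun_ofLp_repr (hM : ∀ m ∈ M, m ∈ posCone L) (v : L2Space (trigSpace M)) :
    trigFun M ((trigBasis hM).repr v).ofLp = v.toFun := by
  rw [← toFun_trigBasis_repr_symm hM, LinearIsometryEquiv.symm_apply_apply]

theorem nontrivial_trigSpace (hM : ∀ m ∈ M, m ∈ posCone L) (hne : M.Nonempty) :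
    Nontrivial (L2Space (trigSpace M)) := by
  obtain ⟨m, hm⟩ := hne
  exact ⟨trigBasis hM (Sum.inl ⟨m, hm⟩), 0, (trigBasis hM).orthonormal.ne_zero _⟩

theorem expectedCritical_trigSpace_mul (hM : ∀ m ∈ M, m ∈ posCone L) (hne : M.Nonempty)
    (hmeas : AEMeasurable fun w => ((criticalSet (trigFun M w)).encard : ℝ≥0∞)) :
    expectedCritical (trigSpace M) * ENNReal.ofReal (√(2 * Real.pi) ^ (2 * M.card)) =
      ∫⁻ w, ((criticalSet (trigFun M w)).encard : ℝ≥0∞) * gaussWeight w := by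
  have := nontrivial_trigSpace hM hne
  have hmeas' := hmeas.comp_quasiMeasurePreserving
    (measurePreserving_ofLp_repr (trigBasis hM)).quasiMeasurePreserving
  simp only [Function.comp_def, trigFun_ofLp_repr] at hmeas'
  have hpolar := expectedCritical_mul_lintegral (trigSpace M) hmeas'
    (g := fun r => ENNReal.ofReal (Real.exp (-(1 / 2) * r ^ 2))) (by fun_prop)
  simp only [← gaussWeight_ofLp_repr (trigBasis hM)] at hpolar
  rw [lintegral_comp_ofLp_repr, lintegral_gaussWeight, Fintype.card_sum, Fintype.card_coe,
    ← two_mul] at hpolar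
  rw [hpolar, ← lintegral_comp_ofLp_repr (trigBasis hM)]
  simp only [trigFun_ofLp_repr]

open Matrix

theorem expectedCritical_trigSpace_mul_eq_lintegral_det (hM : ∀ m ∈ M, m ∈ posCone L)
    (hne : M.Nonempty) (hA : (freqMatrix M * (freqMatrix M)ᵀ).PosDef) :
    expectedCritical (trigSpace M) * ENNReal.ofReal (√(2 * Real.pi) ^ (2 * M.card)) =
      ENNReal.ofReal (fiberConst (freqMatrix M) * (2 * Real.pi) ^ L) * ∫⁻ a : M → ℝ,
        gaussWeight a * ENNReal.ofReal |(freqMatrix M * diagonal a * (freqMatrix M)ᵀ).det| := by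
  rw [expectedCritical_trigSpace_mul hM hne]
  all_goals simp only [encard_criticalSet_trigFun hM hA]
  · rw [lintegral_encard_twist hA, Fintype.card_fin]
  · exact (aemeasurable_encard_twist_and_lintegral _).1

end GaussianAverage

section GramMatrices

open Matrix

variable {κ ι : Type*} [Fintype ι] {K : Matrix κ ι ℝ}

theorem posDef_mul_transpose_iff [Finite κ] : (K * Kᵀ).PosDef ↔ LinearIndependent ℝ K.row := by
  classical
  cases nonempty_fintype κ
  rw [← vecMul_injective_iff, ← conjTranspose_eq_transpose_of_trivial]
  refine ⟨fun h y z hyz => ?_, PosDef.mul_conjTranspose_self K⟩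
  refine vecMul_injective_of_isUnit h.isUnit ?_
  simpa only [vecMul_vecMul] using congrArg (· ᵥ* Kᴴ) hyz

theorem mulVec_surjective_iff_posDef [Finite κ] :
    Function.Surjective K.mulVec ↔ (K * Kᵀ).PosDef := by
  classical
  cases nonempty_fintype κ
  constructor
  · intro h
    rw [posDef_mul_transpose_iff, ← vecMul_injective_iff]
    obtain ⟨B, hB⟩ := mulVec_surjective_iff_exists_right_inverse.1 h
    intro y z hyz
    simpa only [vecMul_vecMul, hB, vecMul_one] using congrArg (· ᵥ* B) hyz
  · intro h y
    refine ⟨Kᵀ *ᵥ ((K * Kᵀ)⁻¹ *ᵥ y), ?_⟩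
    rw [mulVec_mulVec, mulVec_mulVec, mul_nonsing_inv _ h.det_pos.ne'.isUnit, one_mulVec]

theorem mulVec_surjective_iff_det_ne_zero [Fintype κ] [DecidableEq κ] :
    Function.Surjective K.mulVec ↔ (K * Kᵀ).det ≠ 0 := by
  have hpsd : (K * Kᵀ).PosSemidef := by
    rw [← conjTranspose_eq_transpose_of_trivial]
    exact posSemidef_self_mul_conjTranspose K
  rw [mulVec_surjective_iff_posDef, hpsd.posDef_iff_det_ne_zero]

end GramMatrices

section Covariance

open Matrix

variable {L : ℕ}

theorem symMatrix_apply (x : SymIdx L → ℝ) (i j : Fin L) :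
    symMatrix x i j = x ⟨(min i j, max i j), min_le_max⟩ := by
  rw [symMatrix, Matrix.sum_apply, Finset.sum_eq_single ⟨(min i j, max i j), min_le_max⟩]
  · rcases le_total i j with h | h <;> simp [symBasis, h]
  · rintro ⟨⟨k, l⟩, hkl⟩ - hne
    rw [Matrix.smul_apply, symBasis, of_apply, if_neg, smul_zero]
    rintro (⟨rfl, rfl⟩ | ⟨rfl, rfl⟩)
    · simp [min_eq_left hkl, max_eq_right hkl] at hne
    · simp [min_eq_right hkl, max_eq_left hkl] at hne
  · simp

variable (M : Finset (Fin L → ℤ))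

/-- The matrix of the scaled quadratic monomials `m_i m_j` of the frequencies; its Gram matrix is
the covariance matrix. -/
def momentMatrix : Matrix (SymIdx L) M ℝ :=
  Matrix.of fun p m => trigScale L * (freqMatrix M p.1.1 m * freqMatrix M p.1.2 m)

theorem symMatrix_momentMatrix_mulVec (a : M → ℝ) :
    symMatrix (momentMatrix M *ᵥ a) =
      trigScale L • (freqMatrix M * diagonal a * (freqMatrix M)ᵀ) := by
  ext i j
  rw [symMatrix_apply, Matrix.smul_apply, mul_apply]
  simp only [mulVec, dotProduct, momentMatrix, of_apply, mul_diagonal, transpose_apply,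
    smul_eq_mul, Finset.mul_sum]
  refine Finset.sum_congr rfl fun m _ => ?_
  rcases le_total i j with h | h
  · rw [min_eq_left h, max_eq_right h]
    ring
  · rw [min_eq_right h, max_eq_left h]
    ring

theorem aVec_eq_sum (j k : Fin L) : aVec M j k =
    ∑ m : M, (-(trigScale L * (freqMatrix M j m * freqMatrix M k m))) • cosFun m.1 := by
  rw [aVec, ← trigScale, Finset.smul_sum, ← Finset.sum_coe_sort M]
  refine Finset.sum_congr rfl fun m _ => ?_
  rw [smul_smul, neg_mul]
  rfl

theorem aVec_comm (j k : Fin L) : aVec M j k = aVec M k j := by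
  simp only [aVec, mul_comm]

variable {M}

theorem trigFun_sumElim_zero (c : M → ℝ) :
    trigFun M (Sum.elim c 0) = ∑ m, c m • cosFun m.1 := by
  simp [trigFun, trigFamily]

theorem l2Inner_sum_cosFun (hM : ∀ m ∈ M, m ∈ posCone L) (c d : M → ℝ) :
    l2Inner (∑ m, c m • cosFun m.1) (∑ m, d m • cosFun m.1) = c ⬝ᵥ d := by
  have hinner := (trigBasis hM).repr.symm.inner_map_map (WithLp.toLp 2 (Sum.elim c 0))
    (WithLp.toLp 2 (Sum.elim d 0))
  change l2Inner ((trigBasis hM).repr.symm _).toFun ((trigBasis hM).repr.symm _).toFun = _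
    at hinner
  rw [toFun_trigBasis_repr_symm, toFun_trigBasis_repr_symm, trigFun_sumElim_zero,
    trigFun_sumElim_zero] at hinner
  rw [hinner, PiLp.inner_apply]
  simp [dotProduct, mul_comm]

theorem covMatrix_eq (hM : ∀ m ∈ M, m ∈ posCone L) :
    covMatrix M = momentMatrix M * (momentMatrix M)ᵀ := by
  ext p q
  rw [covMatrix, of_apply, aVec_eq_sum, aVec_eq_sum, l2Inner_sum_cosFun hM]
  exact neg_dotProduct_neg _ _

theorem covMatrix_apply (hM : ∀ m ∈ M, m ∈ posCone L) (p q : SymIdx L) :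
    covMatrix M p q = 2 / (2 * Real.pi) ^ L *
      ∑ m ∈ M, (m p.1.1 : ℝ) * (m p.1.2 : ℝ) * (m q.1.1 : ℝ) * (m q.1.2 : ℝ) := by
  rw [covMatrix_eq hM, mul_apply, ← trigScale_sq, Finset.mul_sum, ← Finset.sum_coe_sort M]
  refine Finset.sum_congr rfl fun m _ => ?_
  simp only [momentMatrix, freqMatrix, of_apply, transpose_apply]
  ring

theorem posDef_covMatrix (hM : ∀ m ∈ M, m ∈ posCone L)
    (hlin : LinearIndependent ℝ fun p : SymIdx L => aVec M p.1.1 p.1.2) :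
    (covMatrix M).PosDef := by
  rw [covMatrix_eq hM, posDef_mul_transpose_iff]
  refine LinearIndependent.of_comp (-Fintype.linearCombination ℝ fun m : M => cosFun m.1) ?_
  convert hlin using 2 with p
  simp [aVec_eq_sum, Fintype.linearCombination_apply, momentMatrix, ← Finset.sum_neg_distrib]

theorem linearIndependent_aVec_left
    (hlin : LinearIndependent ℝ fun p : SymIdx L => aVec M p.1.1 p.1.2) (k : Fin L) :
    LinearIndependent ℝ fun j => aVec M j k := by
  have hinj : Function.Injective
      fun j => (⟨(min j k, max j k), min_le_max⟩ : SymIdx L) := by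
    intro i j hij
    simp only [Subtype.mk.injEq, Prod.mk.injEq] at hij
    grind
  convert hlin.comp _ hinj using 2 with j
  rcases le_total j k with h | h
  · simp [h]
  · simp [h, aVec_comm M j k]

theorem posDef_freqMatrix_mul_transpose
    (hlin : LinearIndependent ℝ fun p : SymIdx L => aVec M p.1.1 p.1.2) :
    (freqMatrix M * (freqMatrix M)ᵀ).PosDef := by
  rw [posDef_mul_transpose_iff]
  rcases isEmpty_or_nonempty (Fin L) with hL | ⟨⟨k⟩⟩
  · exact linearIndependent_empty_type
  refine LinearIndependent.of_comp (Fintype.linearCombination ℝ fun m : M =>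
    (-(trigScale L * freqMatrix M k m)) • cosFun m.1) ?_
  convert linearIndependent_aVec_left hlin k using 2 with j
  rw [aVec_eq_sum, Function.comp_apply, Fintype.linearCombination_apply]
  refine Finset.sum_congr rfl fun m _ => ?_
  rw [smul_smul, row_apply]
  congr 1
  ring

theorem nonempty_of_linearIndependent_aVec [NeZero L]
    (hlin : LinearIndependent ℝ fun p : SymIdx L => aVec M p.1.1 p.1.2) : M.Nonempty := by
  by_contra hempty
  rw [Finset.not_nonempty_iff_eq_empty] at hempty
  subst hempty
  exact hlin.ne_zero ⟨(0, 0), le_rfl⟩ (by simp [aVec])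

theorem of_aCoef_eq : Matrix.of (aCoef M) =
    trigScale L ^ 2 • (freqMatrix M * (freqMatrix M)ᵀ) := by
  ext j k
  rw [of_apply, aCoef, ← trigScale_sq, Matrix.smul_apply, mul_apply, ← Finset.sum_coe_sort M]
  rfl

theorem det_of_aCoef : (Matrix.of (aCoef M)).det =
    (trigScale L ^ L) ^ 2 * (freqMatrix M * (freqMatrix M)ᵀ).det := by
  rw [of_aCoef_eq, det_smul, Fintype.card_fin, pow_right_comm]

theorem isAmple_trigSpace_iff_det_ne_zero (hM : ∀ m ∈ M, m ∈ posCone L) :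
    IsAmple (trigSpace M) ↔ (Matrix.of (aCoef M)).det ≠ 0 := by
  rw [isAmple_trigSpace_iff hM, mulVec_surjective_iff_det_ne_zero, det_of_aCoef,
    mul_ne_zero_iff_left (pow_pos (pow_pos (trigScale_pos L) L) 2).ne']

end Covariance

section SymmetricFrequencies

open Matrix

theorem det_of_diag_of_offDiag {n R : Type*} [Fintype n] [DecidableEq n] [Nonempty n] [CommRing R]
    {T : Matrix n n R} {a b : R} (hdiag : ∀ j, T j j = a) (hoff : ∀ j k, j ≠ k → T j k = b) :
    T.det = (a - b) ^ (Fintype.card n - 1) * (a + (Fintype.card n - 1) * b) := by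
  have hT : T = scalar n (a - b) - vecMulVec (fun _ => -b) fun _ => 1 := by
    ext j k
    rcases eq_or_ne j k with rfl | hjk
    · simp [hdiag, vecMulVec_apply]
    · simp [hoff j k hjk, hjk, vecMulVec_apply]
  obtain ⟨k, hk⟩ := Nat.exists_eq_add_one.2 (Fintype.card_pos (α := n))
  rw [hT, ← eval_charpoly, charpoly_vecMulVec, hk]
  simp only [dotProduct, mul_one, Finset.sum_const, Finset.card_univ, hk, nsmul_eq_mul,
    Nat.cast_add, Nat.cast_one, add_tsub_cancel_right, Polynomial.eval_sub,
    Polynomial.eval_mul, Polynomial.eval_pow, Polynomial.eval_X, Polynomial.eval_smul,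
    smul_eq_mul, pow_succ]
  ring

variable {L : ℕ} {M : Finset (Fin L → ℤ)}

theorem det_of_aCoef_of_isSymmetric (hL : 0 < L) (hM : ∀ m ∈ M, m ∈ posCone L)
    (hs : IsSymmetric M) : (Matrix.of (aCoef M)).det =
      (aDiag M - bOff M) ^ (L - 1) * (aDiag M + ((L : ℝ) - 1) * bOff M) := by
  have : NeZero L := ⟨hL.ne'⟩
  simpa only [Fintype.card_fin] using
    det_of_diag_of_offDiag (T := Matrix.of (aCoef M)) (aCoef_diag hM hs)
      fun _ _ => aCoef_off hM hs

theorem aCoef_self_nonneg (j : Fin L) : 0 ≤ aCoef M j j :=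
  mul_nonneg (by positivity) (Finset.sum_nonneg fun m _ => mul_self_nonneg _)

theorem two_mul_aCoef_le (i j : Fin L) : 2 * aCoef M i j ≤ aCoef M i i + aCoef M j j := by
  have hsq : aCoef M i i + aCoef M j j - 2 * aCoef M i j =
      2 / (2 * Real.pi) ^ L * ∑ m ∈ M, ((m i : ℝ) - m j) ^ 2 := by
    simp only [aCoef, Finset.mul_sum, ← Finset.sum_add_distrib, ← Finset.sum_sub_distrib]
    exact Finset.sum_congr rfl fun m _ => by ring
  have hnonneg : 0 ≤ 2 / (2 * Real.pi) ^ L * ∑ m ∈ M, ((m i : ℝ) - m j) ^ 2 := by positivity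
  linarith

theorem bOff_le_aDiag (hL : 0 < L) (hM : ∀ m ∈ M, m ∈ posCone L) (hs : IsSymmetric M) :
    bOff M ≤ aDiag M := by
  by_cases hL1 : 1 < L
  · have hij : (⟨0, hL⟩ : Fin L) ≠ ⟨1, hL1⟩ := by simp
    have hle := two_mul_aCoef_le (M := M) ⟨0, hL⟩ ⟨1, hL1⟩
    rw [aCoef_diag hM hs, aCoef_diag hM hs, aCoef_off hM hs hij] at hle
    linarith
  · rw [bOff, dif_neg hL1, ← aCoef_diag hM hs ⟨0, hL⟩]
    exact aCoef_self_nonneg _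

theorem isAmple_trigSpace_iff_ne (hL : 0 < L) (hM : ∀ m ∈ M, m ∈ posCone L)
    (hs : IsSymmetric M) :
    IsAmple (trigSpace M) ↔ aDiag M ≠ bOff M ∧ aDiag M + ((L : ℝ) - 1) * bOff M ≠ 0 := by
  rw [isAmple_trigSpace_iff_det_ne_zero hM, det_of_aCoef_of_isSymmetric hL hM hs, mul_ne_zero_iff]
  refine and_congr_left fun hsum => ?_
  obtain rfl | hL1 := Nat.eq_or_lt_of_le hL
  · have hb : bOff M = 0 := by simp [bOff]
    simpa [hb] using hsum
  · rw [pow_ne_zero_iff (Nat.sub_pos_of_lt hL1).ne', sub_ne_zero]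

theorem sqrt_det_of_aCoef (hL : 0 < L) (hM : ∀ m ∈ M, m ∈ posCone L) (hs : IsSymmetric M) :
    √(Matrix.of (aCoef M)).det = (aDiag M - bOff M) ^ (((L : ℝ) - 1) / 2) *
      (aDiag M + ((L : ℝ) - 1) * bOff M) ^ (1 / 2 : ℝ) := by
  have hab : 0 ≤ aDiag M - bOff M := sub_nonneg.2 (bOff_le_aDiag hL hM hs)
  rw [det_of_aCoef_of_isSymmetric hL hM hs, Real.sqrt_mul (pow_nonneg hab _), Real.sqrt_eq_rpow,
    Real.sqrt_eq_rpow, ← Real.rpow_natCast_mul hab, Nat.cast_pred hL, mul_one_div]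

end SymmetricFrequencies

section Finiteness

open Matrix

theorem integrable_exp_neg_half_sq_mul_exp_abs (B : ℝ) :
    Integrable fun t : ℝ => Real.exp (-(1 / 2) * t ^ 2) * Real.exp (B * |t|) := by
  refine ((integrable_exp_neg_mul_sq (b := 1 / 4) (by norm_num)).const_mul
    (Real.exp (B ^ 2))).mono' (Continuous.aestronglyMeasurable (by fun_prop))
    (Filter.Eventually.of_forall fun t => ?_)
  rw [Real.norm_of_nonneg (by positivity), ← Real.exp_add, ← Real.exp_add, Real.exp_le_exp]
  nlinarith [sq_nonneg (B - |t| / 2), sq_abs t]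

variable {κ ι : Type*} [Fintype κ] [Fintype ι]

theorem lintegral_gaussWeight_mul_ne_top {h : (ι → ℝ) → ℝ} (c B : ℝ)
    (hle : ∀ a, h a ≤ c * Real.exp (B * ∑ m, |a m|)) :
    ∫⁻ a, gaussWeight a * ENNReal.ofReal (h a) ≠ ∞ := by
  have hint : Integrable fun a : ι → ℝ =>
      c * ∏ m, (Real.exp (-(1 / 2) * a m ^ 2) * Real.exp (B * |a m|)) :=
    (Integrable.fintype_prod fun _ => integrable_exp_neg_half_sq_mul_exp_abs B).const_mul c
  refine ne_top_of_le_ne_top hint.lintegral_lt_top.ne (lintegral_mono fun a => ?_)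
  rw [gaussWeight, ← ENNReal.ofReal_mul (Real.exp_pos _).le]
  refine ENNReal.ofReal_le_ofReal ?_
  calc
    _ ≤ Real.exp (-(1 / 2) * (a ⬝ᵥ a)) * (c * Real.exp (B * ∑ m, |a m|)) :=
      mul_le_mul_of_nonneg_left (hle a) (Real.exp_pos _).le
    _ = _ := by
      rw [Finset.prod_mul_distrib, ← Real.exp_sum, ← Real.exp_sum, ← Finset.mul_sum,
        ← Finset.mul_sum, dotProduct]
      simp only [pow_two]
      ring

variable [DecidableEq κ] [DecidableEq ι]

theorem exists_abs_det_mul_diagonal_mul_transpose_le (A : Matrix κ ι ℝ) :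
    ∃ c B : ℝ, ∀ a : ι → ℝ,
      |(A * diagonal a * Aᵀ).det| ≤ c * Real.exp (B * ∑ m, |a m|) := by
  obtain ⟨B, hB⟩ := Finite.exists_le fun x : κ × κ × ι => |A x.1 x.2.2 * A x.2.1 x.2.2|
  have hentry (a : ι → ℝ) (i j : κ) : |(A * diagonal a * Aᵀ) i j| ≤ |B| * ∑ m, |a m| := by
    rw [mul_apply, Finset.mul_sum]
    refine (Finset.abs_sum_le_sum_abs _ _).trans (Finset.sum_le_sum fun m _ => ?_)
    rw [mul_diagonal, transpose_apply, mul_right_comm, abs_mul]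
    exact mul_le_mul_of_nonneg_right ((hB (i, j, m)).trans (le_abs_self B)) (abs_nonneg _)
  refine ⟨(Fintype.card κ).factorial * (Fintype.card κ).factorial, |B|, fun a => ?_⟩
  have hpow := Real.pow_div_factorial_le_exp (|B| * ∑ m, |a m|) (by positivity) (Fintype.card κ)
  rw [div_le_iff₀' (by positivity)] at hpow
  calc
    _ ≤ (Fintype.card κ).factorial • (|B| * ∑ m, |a m|) ^ Fintype.card κ :=
      det_le (abv := AbsoluteValue.abs) (hentry a)
    _ ≤ _ := by
      rw [nsmul_eq_mul, mul_assoc]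
      gcongr

theorem lintegral_gaussWeight_mul_abs_det_ne_top (A : Matrix κ ι ℝ) :
    ∫⁻ a : ι → ℝ, gaussWeight a * ENNReal.ofReal |(A * diagonal a * Aᵀ).det| ≠ ∞ := by
  obtain ⟨c, B, hle⟩ := exists_abs_det_mul_diagonal_mul_transpose_le A
  exact lintegral_gaussWeight_mul_ne_top c B hle

end Finiteness

section Expectation

open Matrix

variable {L : ℕ} {M : Finset (Fin L → ℤ)}

theorem card_symIdx (L : ℕ) : Fintype.card (SymIdx L) = L + L.choose 2 := by
  rw [← Fintype.card_congr (Sym2.sortEquiv (α := Fin L)), Sym2.card, Fintype.card_fin,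
    Nat.choose_succ_succ, Nat.choose_one_right]

theorem continuous_symMatrix : Continuous (symMatrix : (SymIdx L → ℝ) → _) := by
  unfold symMatrix
  fun_prop

theorem lintegral_gaussWeight_mul_abs_det_eq
    (hK : (momentMatrix M * (momentMatrix M)ᵀ).PosDef) :
    ∫⁻ a : M → ℝ,
        gaussWeight a * ENNReal.ofReal |(freqMatrix M * diagonal a * (freqMatrix M)ᵀ).det| =
      ENNReal.ofReal (fiberConst (momentMatrix M) * (trigScale L ^ L)⁻¹) *
        ∫⁻ x, quadWeight (momentMatrix M * (momentMatrix M)ᵀ)⁻¹ x *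
          ENNReal.ofReal |(symMatrix x).det| := by
  have hscale : 0 < trigScale L ^ L := pow_pos (trigScale_pos L) L
  have hdet : Measurable fun x : SymIdx L → ℝ => ENNReal.ofReal |(symMatrix x).det| :=
    continuous_symMatrix.matrix_det.abs.measurable.ennreal_ofReal
  have hcomp (a : M → ℝ) : ENNReal.ofReal |(freqMatrix M * diagonal a * (freqMatrix M)ᵀ).det| =
      ENNReal.ofReal (trigScale L ^ L)⁻¹ *
        ENNReal.ofReal |(symMatrix (momentMatrix M *ᵥ a)).det| := by
    rw [symMatrix_momentMatrix_mulVec, det_smul, Fintype.card_fin, abs_mul, abs_of_pos hscale,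
      ← ENNReal.ofReal_mul (inv_pos.2 hscale).le, inv_mul_cancel_left₀ hscale.ne']
  have hmeas : Measurable fun a : M → ℝ =>
      gaussWeight a * ENNReal.ofReal |(symMatrix (momentMatrix M *ᵥ a)).det| :=
    continuous_gaussWeight.measurable.mul (hdet.comp (Continuous.measurable (by fun_prop)))
  simp only [hcomp, mul_left_comm _ (ENNReal.ofReal (trigScale L ^ L)⁻¹)]
  rw [lintegral_const_mul _ hmeas, lintegral_gaussWeight_mul_comp_mulVec hK hdet,
    ENNReal.ofReal_mul (fiberConst_nonneg _)]
  ring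

theorem fiberConst_pos {κ ι : Type*} [Fintype κ] [DecidableEq κ] [Fintype ι] {K : Matrix κ ι ℝ}
    (hK : (K * Kᵀ).PosDef) : 0 < fiberConst K := by
  have := hK.det_pos
  unfold fiberConst
  positivity

theorem ofReal_integral_exp_mul_abs_det (hM : ∀ m ∈ M, m ∈ posCone L)
    (hC : (covMatrix M).PosDef) :
    ENNReal.ofReal (∫ x : SymIdx L → ℝ,
        Real.exp (-(1 / 2) * (((covMatrix M)⁻¹).mulVec x ⬝ᵥ x)) * |(symMatrix x).det|) =
      ∫⁻ x, quadWeight (covMatrix M)⁻¹ x * ENNReal.ofReal |(symMatrix x).det| := by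
  have hK : (momentMatrix M * (momentMatrix M)ᵀ).PosDef := covMatrix_eq hM ▸ hC
  have hfinite := lintegral_gaussWeight_mul_abs_det_ne_top (freqMatrix M)
  rw [lintegral_gaussWeight_mul_abs_det_eq hK, ← covMatrix_eq hM] at hfinite
  have hconst : ENNReal.ofReal (fiberConst (momentMatrix M) * (trigScale L ^ L)⁻¹) ≠ 0 :=
    (ENNReal.ofReal_pos.2 (mul_pos (fiberConst_pos hK)
      (inv_pos.2 (pow_pos (trigScale_pos L) L)))).ne'
  have hweight (x : SymIdx L → ℝ) :
      quadWeight (covMatrix M)⁻¹ x * ENNReal.ofReal |(symMatrix x).det| = ENNReal.ofReal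
        (Real.exp (-(1 / 2) * (((covMatrix M)⁻¹).mulVec x ⬝ᵥ x)) * |(symMatrix x).det|) :=
    (ENNReal.ofReal_mul (Real.exp_pos _).le).symm
  have hcont := continuous_symMatrix (L := L)
  have hmeas : AEStronglyMeasurable fun x : SymIdx L → ℝ =>
      Real.exp (-(1 / 2) * (((covMatrix M)⁻¹).mulVec x ⬝ᵥ x)) * |(symMatrix x).det| :=
    Continuous.aestronglyMeasurable (by fun_prop)
  rw [integral_eq_lintegral_of_nonneg_ae (Filter.Eventually.of_forall fun x => by positivity) hmeas]
  simp only [← hweight]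
  exact ENNReal.ofReal_toReal fun htop => hfinite (htop ▸ ENNReal.mul_top hconst)

theorem fiberConst_freqMatrix_mul_fiberConst_momentMatrix (hM : ∀ m ∈ M, m ∈ posCone L) :
    fiberConst (freqMatrix M) * (2 * Real.pi) ^ L *
        (fiberConst (momentMatrix M) * (trigScale L ^ L)⁻¹) / √(2 * Real.pi) ^ (2 * M.card) =
      1 / (√(2 * Real.pi) ^ L.choose 2 * √(Matrix.of (aCoef M)).det * √(covMatrix M).det) := by
  have hscale : 0 < trigScale L ^ L := pow_pos (trigScale_pos L) L
  have hpow : (2 * Real.pi) ^ L = √(2 * Real.pi) ^ L * √(2 * Real.pi) ^ L := by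
    rw [← mul_pow, Real.mul_self_sqrt Real.two_pi_pos.le]
  rw [det_of_aCoef, Real.sqrt_mul (sq_nonneg _), Real.sqrt_sq hscale.le, hpow, fiberConst,
    fiberConst, card_symIdx, ← covMatrix_eq hM, Fintype.card_fin, Fintype.card_coe, two_mul M.card,
    pow_add, pow_add]
  field_simp

theorem expectedCritical_trigSpace_eq (hM : ∀ m ∈ M, m ∈ posCone L) (hne : M.Nonempty)
    (hA : (freqMatrix M * (freqMatrix M)ᵀ).PosDef) (hC : (covMatrix M).PosDef) :
    expectedCritical (trigSpace M) = ENNReal.ofReal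
      (1 / (√(2 * Real.pi) ^ L.choose 2 * √(Matrix.of (aCoef M)).det * √(covMatrix M).det) *
        ∫ x : SymIdx L → ℝ, Real.exp (-(1 / 2) * (((covMatrix M)⁻¹).mulVec x ⬝ᵥ x)) *
          |(symMatrix x).det|) := by
  have hpos : 0 < √(2 * Real.pi) ^ (2 * M.card) := by positivity
  have hcritical := expectedCritical_trigSpace_mul_eq_lintegral_det hM hne hA
  rw [lintegral_gaussWeight_mul_abs_det_eq (covMatrix_eq hM ▸ hC), ← covMatrix_eq hM,
    ← ofReal_integral_exp_mul_abs_det hM hC, ← mul_assoc,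
    ← ENNReal.ofReal_mul (mul_nonneg (fiberConst_nonneg _) (pow_nonneg Real.two_pi_pos.le L))]
    at hcritical
  rw [← fiberConst_freqMatrix_mul_fiberConst_momentMatrix hM, div_mul_eq_mul_div,
    ENNReal.ofReal_div_of_pos hpos, ENNReal.eq_div_iff (ENNReal.ofReal_pos.2 hpos).ne'
      ENNReal.ofReal_ne_top, mul_comm, hcritical, ← ENNReal.ofReal_mul]
  exact mul_nonneg (mul_nonneg (fiberConst_nonneg _) (pow_nonneg Real.two_pi_pos.le L))
    (mul_nonneg (fiberConst_nonneg _) (inv_nonneg.2 (pow_nonneg (trigScale_pos L).le L)))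

theorem expectedCritical_eq (hL : 0 < L) (hM : ∀ m ∈ M, m ∈ posCone L) (hs : IsSymmetric M)
    (hlin : LinearIndependent ℝ fun p : SymIdx L => aVec M p.1.1 p.1.2) :
    expectedCritical (trigSpace M) = ENNReal.ofReal
      (1 / ((2 * Real.pi) ^ ((1 / 2 : ℝ) * (L.choose 2 : ℝ)) *
          (aDiag M - bOff M) ^ (((L : ℝ) - 1) / 2) *
          (aDiag M + ((L : ℝ) - 1) * bOff M) ^ (1 / 2 : ℝ) *
          (covMatrix M).det ^ (1 / 2 : ℝ)) *
        ∫ x : SymIdx L → ℝ, Real.exp (-(1 / 2) * (((covMatrix M)⁻¹).mulVec x ⬝ᵥ x)) *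
          |(symMatrix x).det|) := by
  have : NeZero L := ⟨hL.ne'⟩
  rw [expectedCritical_trigSpace_eq hM (nonempty_of_linearIndependent_aVec hlin)
    (posDef_freqMatrix_mul_transpose hlin) (posDef_covMatrix hM hlin), sqrt_det_of_aCoef hL hM hs,
    Real.rpow_mul_natCast Real.two_pi_pos.le, ← Real.sqrt_eq_rpow (2 * Real.pi), ← mul_assoc,
    Real.sqrt_eq_rpow (covMatrix M).det]

end Expectation

end TrigNewton

end

theorem theorem3p1_general (L : ℕ) (hL : 0 < L) (M : Finset (Fin L → ℤ))
    (hM : ∀ m ∈ M, m ∈ TrigNewton.posCone L) (hsymm : TrigNewton.IsSymmetric M) :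
    (TrigNewton.IsAmple (TrigNewton.trigSpace M) ↔
      TrigNewton.aDiag M ≠ TrigNewton.bOff M ∧
        TrigNewton.aDiag M + ((L : ℝ) - 1) * TrigNewton.bOff M ≠ 0) ∧
    (LinearIndependent ℝ
        (fun p : TrigNewton.SymIdx L => TrigNewton.aVec M p.1.1 p.1.2) →
      (∀ p q : TrigNewton.SymIdx L, TrigNewton.covMatrix M p q =
        2 / (2 * Real.pi) ^ L *
          ∑ m ∈ M, (m p.1.1 : ℝ) * (m p.1.2 : ℝ) * (m q.1.1 : ℝ) * (m q.1.2 : ℝ)) ∧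
      TrigNewton.expectedCritical (TrigNewton.trigSpace M) =
        ENNReal.ofReal
          (1 / ((2 * Real.pi) ^ ((1 / 2 : ℝ) * (L.choose 2 : ℝ)) *
              (TrigNewton.aDiag M - TrigNewton.bOff M) ^ (((L : ℝ) - 1) / 2) *
              (TrigNewton.aDiag M + ((L : ℝ) - 1) * TrigNewton.bOff M) ^ (1 / 2 : ℝ) *
              (TrigNewton.covMatrix M).det ^ (1 / 2 : ℝ)) *
            ∫ x : TrigNewton.SymIdx L → ℝ,
              Real.exp (-(1 / 2) * (((TrigNewton.covMatrix M)⁻¹).mulVec x ⬝ᵥ x)) *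
                |(TrigNewton.symMatrix x).det|)) :=
  ⟨TrigNewton.isAmple_trigSpace_iff_ne hL hM hsymm, fun hlin =>
    ⟨TrigNewton.covMatrix_apply hM, TrigNewton.expectedCritical_eq hL hM hsymm hlin⟩⟩

theorem theorem3p1 (L : ℕ) (hL : 0 < L) (M : Finset (Fin L → ℤ))
    (hM : ∀ m ∈ M, m ∈ TrigNewton.posCone L) (hsymm : TrigNewton.IsSymmetric M)
    (hcard : L < M.card) :
    (TrigNewton.IsAmple (TrigNewton.trigSpace M) ↔
      TrigNewton.aDiag M ≠ TrigNewton.bOff M ∧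
        TrigNewton.aDiag M + ((L : ℝ) - 1) * TrigNewton.bOff M ≠ 0) ∧
    (LinearIndependent ℝ
        (fun p : TrigNewton.SymIdx L => TrigNewton.aVec M p.1.1 p.1.2) →
      (∀ p q : TrigNewton.SymIdx L, TrigNewton.covMatrix M p q =
        2 / (2 * Real.pi) ^ L *
          ∑ m ∈ M, (m p.1.1 : ℝ) * (m p.1.2 : ℝ) * (m q.1.1 : ℝ) * (m q.1.2 : ℝ)) ∧
      TrigNewton.expectedCritical (TrigNewton.trigSpace M) =
        ENNReal.ofReal
          (1 / ((2 * Real.pi) ^ ((1 / 2 : ℝ) * (L.choose 2 : ℝ)) *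
              (TrigNewton.aDiag M - TrigNewton.bOff M) ^ (((L : ℝ) - 1) / 2) *
              (TrigNewton.aDiag M + ((L : ℝ) - 1) * TrigNewton.bOff M) ^ (1 / 2 : ℝ) *
              (TrigNewton.covMatrix M).det ^ (1 / 2 : ℝ)) *
            ∫ x : TrigNewton.SymIdx L → ℝ,
              Real.exp (-(1 / 2) * (((TrigNewton.covMatrix M)⁻¹).mulVec x ⬝ᵥ x)) *
                |(TrigNewton.symMatrix x).det|)) :=
  theorem3p1_general L hL M hM hsymm
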